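/- Let $k$ be a field of characteristic zero. A \emph{dendriform-Nijenhuis algebra} is a $k$-vector space with nine bilinear operations $\nearrow,\searrow,\swarrow,\nwarrow,\uparrow,\downarrow,\tilde\prec,\tilde\succ,\tilde\bullet$ such that, writing $$\triangleleft=\nwarrow+\swarrow+\tilde\prec,\quad \triangleright=\nearrow+\searrow+\tilde\succ,\quad \bar\bullet=\uparrow+\downarrow+\tilde\bullet,$$ $$\wedge=\nwarrow+\nearrow+\uparrow,\quad \vee=\searrow+\swarrow+\downarrow,\quad \tilde\star=\tilde\prec+\tilde\succ+\tilde\bullet,$$ and $\bar\star$ for the sum of the nine operations, the following 28 relations hold for all $x,y,z$: $$\begin{array}{lll} (x\nwarrow y)\nwarrow z=x\nwarrow(y\bar\star z), & (x\nearrow y)\nwarrow z=x\nearrow(y\triangleleft z), & (x\wedge y)\nearrow z=x\nearrow(y\triangleright z),\\ (x\swarrow y)\nwarrow z=x\swarrow(y\wedge z), & (x\searrow y)\nwarrow z=x\searrow(y\nwarrow z), & (x\vee y)\nearrow z=x\searrow(y\nearrow z),\\ (x\triangleleft y)\swarrow z=x\swarrow(y\vee z), & (x\triangleright y)\swarrow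 z=x\searrow(y\swarrow z), & (x\bar\star y)\searrow z=x\searrow(y\searrow z),\\ (x\swarrow y)\tilde\prec z=x\swarrow(y\tilde\star z), & (x\searrow y)\tilde\prec z=x\searrow(y\tilde\prec z), & (x\vee y)\tilde\succ z=x\searrow(y\tilde\succ z),\\ (x\nwarrow y)\tilde\prec z=x\tilde\prec(y\vee z), & (x\nearrow y)\tilde\prec z=x\tilde\succ(y\swarrow z), & (x\wedge y)\tilde\succ z=x\tilde\succ(y\searrow z),\\ (x\tilde\prec y)\nwarrow z=x\tilde\prec(y\wedge z), & (x\tilde\succ y)\nwarrow z=x\tilde\succ(y\nwarrow z), & (x\tilde\star y)\nearrow z=x\tilde\succ(y\nearrow z),\\ (x\tilde\prec y)\tilde\prec z=x\tilde\prec(y\tilde\star z), & (x\tilde\succ y)\tilde\prec z=x\tilde\succ(y\tilde\prec z), & (x\tilde\star y)\tilde\succ z=x\tilde\succ(y\tilde\succ z), \end{array}$$ $$\begin{array}{l} (x\wedge y)\uparrow z+(x\uparrow y)\nwarrow z=x\nearrow(y\bar\bullet z)+x\uparrow(y\bar\star z),\\ (x\vee y)\uparrow z+(x\downarrow y)\nwarrow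 z=x\searrow(y\uparrow z)+x\downarrow(y\wedge z),\\ (x\bar\star y)\downarrow z+(x\bar\bullet y)\swarrow z=x\searrow(y\downarrow z)+x\downarrow(y\vee z),\\ (x\vee y)\tilde\bullet z+(x\downarrow y)\tilde\prec z=x\searrow(y\tilde\bullet z)+x\downarrow(y\tilde\star z),\\ (x\wedge y)\tilde\bullet z+(x\uparrow y)\tilde\prec z=x\tilde\succ(y\downarrow z)+x\tilde\bullet(y\vee z),\\ (x\tilde\star y)\uparrow z+(x\tilde\bullet y)\nwarrow z=x\tilde\succ(y\uparrow z)+x\tilde\bullet(y\wedge z),\\ (x\tilde\star y)\tilde\bullet z+(x\tilde\bullet y)\tilde\prec z=x\tilde\succ(y\tilde\bullet z)+x\tilde\bullet(y\tilde\star z). \end{array}$$ (Then $\bar\star$ is associative.) It is \emph{commutative} if $x\searrow y=y\nwarrow x$, $x\nearrow y=y\swarrow x$, $x\uparrow y=y\downarrow x$, $x\tilde\succ y=y\tilde\prec x$ and $x\tilde\bullet y=y\tilde\bullet x$ for all $x,y$. The free (commutative) dendriform-Nijenhuis algebra on a vector space $V$ is the one, equipped with a linear map from $V$, that has the usual universal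 property for linear maps from $V$ to (commutative) dendriform-Nijenhuis algebras. For a dendriform-Nijenhuis algebra $A$ let $A_+=k1\oplus A$, a unital associative algebra for the product $\bar\star$ extended by $x\,\bar\star\,1=x=1\,\bar\star\,x$. The \emph{unit action} is: $x\nwarrow1=x$, $1\nwarrow x=0$, $1\searrow x=x$, $x\searrow1=0$, and $x\diamond1=0=1\diamond x$ for the other seven operations ($x\in A$). For dendriform-Nijenhuis algebras $A,B$ let $A\boxtimes B=A\otimes k1\,\oplus\,k1\otimes B\,\oplus\,A\otimes B\subset A_+\otimes B_+$, with, for each of the nine operations $\diamond$, $$(a\otimes b)\diamond(a'\otimes b')=(a\,\bar\star\,a')\otimes(b\diamond b')\ \text{ if } b\in B \text{ or } b'\in B,\qquad (a\otimes1)\diamond(a'\otimes1)=(a\diamond a')\otimes1 .$$ A bialgebra $H$ is \emph{connected} if $H=\bigcup_rF_r$ for the increasing filtration $F_0=k1$, $F_r=\{x:\Delta(x)-1\otimes x-x\otimes1\in F_{r-1}\otimes F_{r-1}\}$ for $r\ge1$. \textbf{Statement.} (1) The unit action is coherent: for all dendriform-Nijenhuis algebras $A,B$, the space $A\boxtimes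 B$ with these operations is a dendriform-Nijenhuis algebra, and it is commutative if $A$ and $B$ are. (2) Let $F$ be the free dendriform-Nijenhuis algebra $\mathcal{DN}(V)$ on a $k$-vector space $V$. Then the unital algebra $(F_+,\bar\star,1)$ carries a connected Hopf algebra structure. Its counit is the projection $F_+\to k1$; its coproduct $\Delta$ satisfies $\Delta(v)=1\otimes v+v\otimes1$ for $v\in V$, maps $F$ into $F\boxtimes F$, and $\Delta(x\diamond y)=\Delta(x)\diamond\Delta(y)$ for all $x,y\in F$ and each of the nine operations $\diamond$. (3) The same holds when $F$ is the free commutative dendriform-Nijenhuis algebra on $V$. -/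

import Mathlib

open scoped TensorProduct

universe u v w

/-- The nine operation symbols of a dendriform-Nijenhuis algebra:
`ne` is `↗`, `se` is `↘`, `sw` is `↙`, `nw` is `↖`, `up` is `↑`, `dn` is `↓`, and
`pre`, `suc`, `bul` are the tilded versions of `≺`, `≻`, `•`. -/
inductive DNOp : Type
  | ne | se | sw | nw | up | dn | pre | suc | bul

/-- Nine bilinear operations on a `k`-module. -/
abbrev DNOps (k : Type u) (A : Type v) [Field k] [AddCommGroup A] [Module k A] :=
  DNOp → A →ₗ[k] A →ₗ[k] A

namespace DNOps

variable {k : Type u} {A : Type v} [Field k] [AddCommGroup A] [Module k A] (o : DNOps k A)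

/-- `x ◁ y` -/
def lt (x y : A) : A := o .nw x y + o .sw x y + o .pre x y

/-- `x ▷ y` -/
def rt (x y : A) : A := o .ne x y + o .se x y + o .suc x y

/-- `x •̄ y` (barred bullet) -/
def bb (x y : A) : A := o .up x y + o .dn x y + o .bul x y

/-- `x ∧ y` -/
def we (x y : A) : A := o .nw x y + o .ne x y + o .up x y

/-- `x ∨ y` -/
def ve (x y : A) : A := o .se x y + o .sw x y + o .dn x y

/-- `x ⋆̃ y` (tilded star) -/
def ts (x y : A) : A := o .pre x y + o .suc x y + o .bul x y

/-- `x ⋆̄ y` (barred star): the sum of the nine operations. -/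
def star (x y : A) : A :=
  o .ne x y + o .se x y + o .sw x y + o .nw x y + o .up x y + o .dn x y
    + o .pre x y + o .suc x y + o .bul x y

end DNOps

/-- The 28 relations of a dendriform-Nijenhuis algebra. -/
structure IsDendNij {k : Type u} {A : Type v} [Field k] [AddCommGroup A] [Module k A]
    (o : DNOps k A) : Prop where
  m11 : ∀ x y z, o .nw (o .nw x y) z = o .nw x (o.star y z)
  m12 : ∀ x y z, o .nw (o .ne x y) z = o .ne x (o.lt y z)
  m13 : ∀ x y z, o .ne (o.we x y) z = o .ne x (o.rt y z)
  m21 : ∀ x y z, o .nw (o .sw x y) z = o .sw x (o.we y z)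
  m22 : ∀ x y z, o .nw (o .se x y) z = o .se x (o .nw y z)
  m23 : ∀ x y z, o .ne (o.ve x y) z = o .se x (o .ne y z)
  m31 : ∀ x y z, o .sw (o.lt x y) z = o .sw x (o.ve y z)
  m32 : ∀ x y z, o .sw (o.rt x y) z = o .se x (o .sw y z)
  m33 : ∀ x y z, o .se (o.star x y) z = o .se x (o .se y z)
  m41 : ∀ x y z, o .pre (o .sw x y) z = o .sw x (o.ts y z)
  m42 : ∀ x y z, o .pre (o .se x y) z = o .se x (o .pre y z)
  m43 : ∀ x y z, o .suc (o.ve x y) z = o .se x (o .suc y z)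
  m51 : ∀ x y z, o .pre (o .nw x y) z = o .pre x (o.ve y z)
  m52 : ∀ x y z, o .pre (o .ne x y) z = o .suc x (o .sw y z)
  m53 : ∀ x y z, o .suc (o.we x y) z = o .suc x (o .se y z)
  m61 : ∀ x y z, o .nw (o .pre x y) z = o .pre x (o.we y z)
  m62 : ∀ x y z, o .nw (o .suc x y) z = o .suc x (o .nw y z)
  m63 : ∀ x y z, o .ne (o.ts x y) z = o .suc x (o .ne y z)
  m71 : ∀ x y z, o .pre (o .pre x y) z = o .pre x (o.ts y z)
  m72 : ∀ x y z, o .pre (o .suc x y) z = o .suc x (o .pre y z)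
  m73 : ∀ x y z, o .suc (o.ts x y) z = o .suc x (o .suc y z)
  n1 : ∀ x y z, o .up (o.we x y) z + o .nw (o .up x y) z
    = o .ne x (o.bb y z) + o .up x (o.star y z)
  n2 : ∀ x y z, o .up (o.ve x y) z + o .nw (o .dn x y) z
    = o .se x (o .up y z) + o .dn x (o.we y z)
  n3 : ∀ x y z, o .dn (o.star x y) z + o .sw (o.bb x y) z
    = o .se x (o .dn y z) + o .dn x (o.ve y z)
  n4 : ∀ x y z, o .bul (o.ve x y) z + o .pre (o .dn x y) z
    = o .se x (o .bul y z) + o .dn x (o.ts y z)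
  n5 : ∀ x y z, o .bul (o.we x y) z + o .pre (o .up x y) z
    = o .suc x (o .dn y z) + o .bul x (o.ve y z)
  n6 : ∀ x y z, o .up (o.ts x y) z + o .nw (o .bul x y) z
    = o .suc x (o .up y z) + o .bul x (o.we y z)
  n7 : ∀ x y z, o .bul (o.ts x y) z + o .pre (o .bul x y) z
    = o .suc x (o .bul y z) + o .bul x (o.ts y z)

/-- The symbol `c'` such that `x c^op y = y c' x`. -/
def DNOp.opp : DNOp → DNOp
  | .se => .nw
  | .ne => .sw
  | .nw => .se
  | .sw => .ne
  | .up => .dn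
  | .dn => .up
  | .suc => .pre
  | .bul => .bul
  | .pre => .suc

/-- The structure coincides with its opposite. -/
def IsCommDN {k : Type u} {A : Type v} [Field k] [AddCommGroup A] [Module k A]
    (o : DNOps k A) : Prop :=
  ∀ c x y, o c x y = o c.opp y x

/-- A linear map respecting the nine operations. -/
def IsDNHom {k : Type u} {A : Type v} {B : Type w} [Field k] [AddCommGroup A] [Module k A]
    [AddCommGroup B] [Module k B] (oA : DNOps k A) (oB : DNOps k B) (g : A →ₗ[k] B) : Prop :=
  ∀ c x y, g (oA c x y) = oB c (g x) (g y)

/-- `(F, o)` with `i : V → F` is a free dendriform-Nijenhuis algebra on the vector space `V`. -/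
structure IsFreeDN {k : Type u} {V : Type v} {F : Type (max u v)} [Field k] [AddCommGroup V]
    [Module k V] [AddCommGroup F] [Module k F] (o : DNOps k F) (i : V →ₗ[k] F) : Prop where
  isDendNij : IsDendNij o
  existsUnique_lift : ∀ (A : Type (max u v)) [AddCommGroup A] [Module k A] (oA : DNOps k A),
    IsDendNij oA → ∀ f : V →ₗ[k] A, ∃! g : F →ₗ[k] A, IsDNHom o oA g ∧ g ∘ₗ i = f

/-- `(F, o)` with `i : V → F` is a free commutative dendriform-Nijenhuis algebra on the
vector space `V`. -/
structure IsFreeCommDN {k : Type u} {V : Type v} {F : Type (max u v)} [Field k] [AddCommGroup V]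
    [Module k V] [AddCommGroup F] [Module k F] (o : DNOps k F) (i : V →ₗ[k] F) : Prop where
  isDendNij : IsDendNij o
  isComm : IsCommDN o
  existsUnique_lift : ∀ (A : Type (max u v)) [AddCommGroup A] [Module k A] (oA : DNOps k A),
    IsDendNij oA → IsCommDN oA →
      ∀ f : V →ₗ[k] A, ∃! g : F →ₗ[k] A, IsDNHom o oA g ∧ g ∘ₗ i = f

/-! ### Existence of free algebras -/

section Hom

variable {k : Type u} {A : Type v} {B : Type w} [Field k] [AddCommGroup A] [Module k A]
  [AddCommGroup B] [Module k B] {oA : DNOps k A} {oB : DNOps k B} {g : A →ₗ[k] B}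

theorem IsDNHom.map_lt (h : IsDNHom oA oB g) (x y : A) :
    g (oA.lt x y) = oB.lt (g x) (g y) := by
  simp only [DNOps.lt, map_add, h _ x y]

theorem IsDNHom.map_rt (h : IsDNHom oA oB g) (x y : A) :
    g (oA.rt x y) = oB.rt (g x) (g y) := by
  simp only [DNOps.rt, map_add, h _ x y]

theorem IsDNHom.map_bb (h : IsDNHom oA oB g) (x y : A) :
    g (oA.bb x y) = oB.bb (g x) (g y) := by
  simp only [DNOps.bb, map_add, h _ x y]

theorem IsDNHom.map_we (h : IsDNHom oA oB g) (x y : A) :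
    g (oA.we x y) = oB.we (g x) (g y) := by
  simp only [DNOps.we, map_add, h _ x y]

theorem IsDNHom.map_ve (h : IsDNHom oA oB g) (x y : A) :
    g (oA.ve x y) = oB.ve (g x) (g y) := by
  simp only [DNOps.ve, map_add, h _ x y]

theorem IsDNHom.map_ts (h : IsDNHom oA oB g) (x y : A) :
    g (oA.ts x y) = oB.ts (g x) (g y) := by
  simp only [DNOps.ts, map_add, h _ x y]

theorem IsDNHom.map_star (h : IsDNHom oA oB g) (x y : A) :
    g (oA.star x y) = oB.star (g x) (g y) := by
  simp only [DNOps.star, map_add, h _ x y]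

end Hom

theorem IsDendNij.of_joint {k : Type u} {F : Type v} [Field k] [AddCommGroup F] [Module k F]
    {o : DNOps k F} (e : ∀ x y : F, (∀ (A : Type w) [AddCommGroup A] [Module k A]
      (oA : DNOps k A) (g : F →ₗ[k] A), IsDendNij oA → IsDNHom o oA g → g x = g y) → x = y) :
    IsDendNij o := by
  constructor <;> intro x y z <;> refine e _ _ fun A _ _ oA g h H => ?_ <;>
    simp only [map_add, H.map_lt, H.map_rt, H.map_bb, H.map_we, H.map_ve, H.map_ts, H.map_star,
      H _ _ _]
  · exact h.m11 _ _ _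
  · exact h.m12 _ _ _
  · exact h.m13 _ _ _
  · exact h.m21 _ _ _
  · exact h.m22 _ _ _
  · exact h.m23 _ _ _
  · exact h.m31 _ _ _
  · exact h.m32 _ _ _
  · exact h.m33 _ _ _
  · exact h.m41 _ _ _
  · exact h.m42 _ _ _
  · exact h.m43 _ _ _
  · exact h.m51 _ _ _
  · exact h.m52 _ _ _
  · exact h.m53 _ _ _
  · exact h.m61 _ _ _
  · exact h.m62 _ _ _
  · exact h.m63 _ _ _
  · exact h.m71 _ _ _
  · exact h.m72 _ _ _
  · exact h.m73 _ _ _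
  · exact h.n1 _ _ _
  · exact h.n2 _ _ _
  · exact h.n3 _ _ _
  · exact h.n4 _ _ _
  · exact h.n5 _ _ _
  · exact h.n6 _ _ _
  · exact h.n7 _ _ _

section Free

/-- Planar binary trees with internal vertices decorated by operations and leaves by `V`. -/
inductive DNTree (V : Type v) : Type v
  | leaf : V → DNTree V
  | node : DNOp → DNTree V → DNTree V → DNTree V

variable {k : Type u} {V : Type v} [Field k]

/-- Evaluation of a tree in an algebra. -/
def DNTree.eval {A : Type w} [AddCommGroup A] [Module k A] (oA : DNOps k A) (f : V → A) :
    DNTree V → A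
  | .leaf v => f v
  | .node c s t => oA c (s.eval oA f) (t.eval oA f)

/-- Linear combinations of trees. -/
abbrev DNPre (k : Type u) (V : Type v) [Field k] := DNTree V →₀ k

namespace DNPre

/-- Grafting of trees, extended bilinearly. -/
noncomputable def op (k : Type u) (V : Type v) [Field k] : DNOps k (DNPre k V) := fun c =>
  Finsupp.linearCombination k fun s =>
    Finsupp.linearCombination k fun t => Finsupp.single (DNTree.node c s t) (1 : k)

/-- Evaluation, extended linearly. -/
noncomputable def eval {A : Type w} [AddCommGroup A] [Module k A] (oA : DNOps k A) (f : V → A) :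
    DNPre k V →ₗ[k] A := Finsupp.linearCombination k (DNTree.eval oA f)

theorem op_single (c : DNOp) (s t : DNTree V) :
    op k V c (Finsupp.single s 1) (Finsupp.single t 1) = Finsupp.single (.node c s t) 1 := by
  rw [op, Finsupp.linearCombination_single, one_smul, Finsupp.linearCombination_single, one_smul]

theorem eval_single {A : Type w} [AddCommGroup A] [Module k A] (oA : DNOps k A) (f : V → A)
    (t : DNTree V) : eval oA f (Finsupp.single t 1) = t.eval oA f := by
  rw [eval, Finsupp.linearCombination_single, one_smul]

theorem eval_op {A : Type w} [AddCommGroup A] [Module k A] (oA : DNOps k A) (f : V → A)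
    (c : DNOp) (x y : DNPre k V) :
    eval oA f (op k V c x y) = oA c (eval oA f x) (eval oA f y) := by
  induction x using Finsupp.induction_linear with
  | zero => simp
  | add x x' hx hx' => simp [hx, hx']
  | single s r =>
    induction y using Finsupp.induction_linear with
    | zero => simp
    | add y y' hy hy' => simp [hy, hy']
    | single t r' =>
      rw [← Finsupp.smul_single_one s, ← Finsupp.smul_single_one t]
      simp only [map_smul, LinearMap.smul_apply, op_single, eval_single, DNTree.eval]

/-- The elements that vanish in every (commutative, if `b` holds) dendriform-Nijenhuis algebra. -/
def rel (k : Type u) (V : Type v) [Field k] [AddCommGroup V] [Module k V] (b : Prop) :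
    Submodule k (DNPre k V) where
  carrier := {x | ∀ (A : Type (max u v)) [AddCommGroup A] [Module k A] (oA : DNOps k A)
    (f : V →ₗ[k] A), IsDendNij oA → (b → IsCommDN oA) → eval oA f x = 0}
  add_mem' hx hy A _ _ oA f h h' := by rw [map_add, hx A oA f h h', hy A oA f h h', add_zero]
  zero_mem' A _ _ oA f h h' := map_zero _
  smul_mem' r x hx A _ _ oA f h h' := by rw [map_smul, hx A oA f h h', smul_zero]

end DNPre

/-- The free (commutative, if `b` holds) dendriform-Nijenhuis algebra. -/
abbrev FreeDN (k : Type u) (V : Type v) [Field k] [AddCommGroup V] [Module k V] (b : Prop) :=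
  DNPre k V ⧸ DNPre.rel k V b

namespace FreeDN

open DNPre

variable [AddCommGroup V] [Module k V] (b : Prop)

/-- The operations of the free algebra. -/
noncomputable def ops (k : Type u) (V : Type v) [Field k] [AddCommGroup V] [Module k V]
    (b : Prop) : DNOps k (FreeDN k V b) := fun c =>
  (rel k V b).liftQ
    (LinearMap.flip ((rel k V b).liftQ ((op k V c).compr₂ (rel k V b).mkQ).flip
      (fun y hy => by
        refine LinearMap.ext fun x => ?_
        refine (Submodule.Quotient.mk_eq_zero _).2 ?_
        intro A _ _ oA f h h'
        rw [eval_op, hy A oA f h h', map_zero])))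
    (fun x hx => by
      refine LinearMap.ext fun y => ?_
      obtain ⟨y, rfl⟩ := (rel k V b).mkQ_surjective y
      refine (Submodule.Quotient.mk_eq_zero _).2 ?_
      intro A _ _ oA f h h'
      rw [eval_op, hx A oA f h h', map_zero, LinearMap.zero_apply])

theorem ops_mk (c : DNOp) (x y : DNPre k V) :
    ops k V b c ((rel k V b).mkQ x) ((rel k V b).mkQ y) = (rel k V b).mkQ (op k V c x y) := rfl

variable {b}

/-- The morphism to an algebra `A` induced by a linear map `V → A`. -/
noncomputable def lift {A : Type (max u v)} [AddCommGroup A] [Module k A] {oA : DNOps k A}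
    (h : IsDendNij oA) (h' : b → IsCommDN oA) (f : V →ₗ[k] A) : FreeDN k V b →ₗ[k] A :=
  (rel k V b).liftQ (eval oA f) (fun _ hx => hx A oA f h h')

theorem lift_ops {A : Type (max u v)} [AddCommGroup A] [Module k A] {oA : DNOps k A}
    (h : IsDendNij oA) (h' : b → IsCommDN oA) (f : V →ₗ[k] A) (c : DNOp) (x y : FreeDN k V b) :
    lift h h' f (ops k V b c x y) = oA c (lift h h' f x) (lift h h' f y) := by
  obtain ⟨x, rfl⟩ := (rel k V b).mkQ_surjective x
  obtain ⟨y, rfl⟩ := (rel k V b).mkQ_surjective y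
  exact eval_op oA f c x y

theorem ext_lift {x y : FreeDN k V b} (e : ∀ (A : Type (max u v)) [AddCommGroup A] [Module k A]
    (oA : DNOps k A) (f : V →ₗ[k] A) (h : IsDendNij oA) (h' : b → IsCommDN oA),
    lift h h' f x = lift h h' f y) : x = y := by
  obtain ⟨x, rfl⟩ := (rel k V b).mkQ_surjective x
  obtain ⟨y, rfl⟩ := (rel k V b).mkQ_surjective y
  refine (Submodule.Quotient.eq _).2 fun A _ _ oA f h h' => ?_
  rw [map_sub, sub_eq_zero]
  exact e A oA f h h'

variable (k V b)

/-- The inclusion of the generators. -/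
noncomputable def gen : V →ₗ[k] FreeDN k V b where
  toFun v := (rel k V b).mkQ (Finsupp.single (DNTree.leaf v) 1)
  map_add' v v' := ext_lift fun A _ _ oA f h h' => by simp [lift, eval, DNTree.eval]
  map_smul' r v := ext_lift fun A _ _ oA f h h' => by simp [lift, eval, DNTree.eval]

theorem isDendNij : IsDendNij (ops k V b) := by
  refine IsDendNij.of_joint fun x y e => ext_lift fun A _ _ oA f h h' => ?_
  exact e A oA (lift h h' f) h (lift_ops h h' f)

theorem isComm (hb : b) : IsCommDN (ops k V b) := fun c x y =>
  ext_lift fun A _ _ oA f h h' => by rw [lift_ops, lift_ops]; exact h' hb c _ _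

theorem existsUnique_lift {A : Type (max u v)} [AddCommGroup A] [Module k A] {oA : DNOps k A}
    (h : IsDendNij oA) (h' : b → IsCommDN oA) (f : V →ₗ[k] A) :
    ∃! g : FreeDN k V b →ₗ[k] A, IsDNHom (ops k V b) oA g ∧ g ∘ₗ gen k V b = f := by
  refine ⟨lift h h' f, ⟨lift_ops h h' f, ?_⟩, fun g hg => ?_⟩
  · ext v
    simp [lift, gen, eval, DNTree.eval]
  · have key : ∀ t : DNTree V,
        g ((rel k V b).mkQ (Finsupp.single t 1)) = DNTree.eval oA f t := by
      intro t
      induction t with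
      | leaf v => exact LinearMap.congr_fun hg.2 v
      | node c s t hs ht =>
        rw [DNTree.eval, ← hs, ← ht, ← hg.1, ops_mk, op_single]
    ext t
    simpa [lift, eval] using key t

end FreeDN

theorem FreeDN.isFreeDN (k : Type u) (V : Type v) [Field k] [AddCommGroup V] [Module k V] :
    IsFreeDN (FreeDN.ops k V False) (FreeDN.gen k V False) :=
  ⟨FreeDN.isDendNij k V False,
    fun _ _ _ _ h f => FreeDN.existsUnique_lift k V False h (fun e => e.elim) f⟩

theorem FreeDN.isFreeCommDN (k : Type u) (V : Type v) [Field k] [AddCommGroup V] [Module k V] :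
    IsFreeCommDN (FreeDN.ops k V True) (FreeDN.gen k V True) :=
  ⟨FreeDN.isDendNij k V True, FreeDN.isComm k V True trivial,
    fun _ _ _ _ h h' f => FreeDN.existsUnique_lift k V True h (fun _ => h') f⟩

end Free

/-! ### The augmented algebra `k1 ⊕ A` -/

theorem IsDendNij.star_assoc {k : Type u} {A : Type v} [Field k] [AddCommGroup A] [Module k A]
    {o : DNOps k A} (h : IsDendNij o) (x y z : A) :
    o.star (o.star x y) z = o.star x (o.star y z) := by
  have e11 := h.m11 x y z
  have e12 := h.m12 x y z
  have e13 := h.m13 x y z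
  have e21 := h.m21 x y z
  have e22 := h.m22 x y z
  have e23 := h.m23 x y z
  have e31 := h.m31 x y z
  have e32 := h.m32 x y z
  have e33 := h.m33 x y z
  have e41 := h.m41 x y z
  have e42 := h.m42 x y z
  have e43 := h.m43 x y z
  have e51 := h.m51 x y z
  have e52 := h.m52 x y z
  have e53 := h.m53 x y z
  have e61 := h.m61 x y z
  have e62 := h.m62 x y z
  have e63 := h.m63 x y z
  have e71 := h.m71 x y z
  have e72 := h.m72 x y z
  have e73 := h.m73 x y z
  have d1 := h.n1 x y z
  have d2 := h.n2 x y z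
  have d3 := h.n3 x y z
  have d4 := h.n4 x y z
  have d5 := h.n5 x y z
  have d6 := h.n6 x y z
  have d7 := h.n7 x y z
  simp only [DNOps.star, DNOps.lt, DNOps.rt, DNOps.bb, DNOps.we, DNOps.ve, DNOps.ts, map_add,
    LinearMap.add_apply] at *
  linear_combination (norm := abel) e11 + e12 + e13 + e21 + e22 + e23 + e31 + e32 + e33 + e41 + e42
    + e43 + e51 + e52 + e53 + e61 + e62 + e63 + e71 + e72 + e73 + d1 + d2 + d3 + d4 + d5 + d6 + d7

/-- The vector space `A` with the associative (non-unital) product `⋆̄`. -/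
@[nolint unusedArguments]
def StarAlg {k : Type u} {A : Type v} [Field k] [AddCommGroup A] [Module k A]
    {o : DNOps k A} (_h : IsDendNij o) : Type v := A

namespace StarAlg

variable {k : Type u} {A : Type v} [Field k] [AddCommGroup A] [Module k A]
  {o : DNOps k A} (h : IsDendNij o)

instance : AddCommGroup (StarAlg h) := inferInstanceAs (AddCommGroup A)

instance : Module k (StarAlg h) := inferInstanceAs (Module k A)

/-- The identity map `A → StarAlg h`. -/
def of : A ≃ₗ[k] StarAlg h := LinearEquiv.refl k A

instance : NonUnitalRing (StarAlg h) where
  mul x y := of h (o.star ((of h).symm x) ((of h).symm y))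
  left_distrib x y z := by
    change of h (o.star ((of h).symm x) ((of h).symm (y + z)))
      = of h (o.star ((of h).symm x) ((of h).symm y))
        + of h (o.star ((of h).symm x) ((of h).symm z))
    rw [← map_add]; congr 1; simp only [DNOps.star, map_add]; abel
  right_distrib x y z := by
    change of h (o.star ((of h).symm (x + y)) ((of h).symm z))
      = of h (o.star ((of h).symm x) ((of h).symm z))
        + of h (o.star ((of h).symm y) ((of h).symm z))
    rw [← map_add]; congr 1; simp only [DNOps.star, map_add, LinearMap.add_apply]; abel
  zero_mul x := by
    change of h (o.star ((of h).symm 0) ((of h).symm x)) = 0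
    simp [DNOps.star]
  mul_zero x := by
    change of h (o.star ((of h).symm x) ((of h).symm 0)) = 0
    simp [DNOps.star]
  mul_assoc x y z := h.star_assoc x y z

theorem of_mul_of (x y : A) : of h x * of h y = of h (o.star x y) := rfl

instance : IsScalarTower k (StarAlg h) (StarAlg h) where
  smul_assoc r x y := by
    change of h (o.star ((of h).symm (r • x)) ((of h).symm y))
      = r • of h (o.star ((of h).symm x) ((of h).symm y))
    simp [DNOps.star, smul_add]

instance : SMulCommClass k (StarAlg h) (StarAlg h) where
  smul_comm r x y := by
    change r • of h (o.star ((of h).symm x) ((of h).symm y))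
      = of h (o.star ((of h).symm x) ((of h).symm (r • y)))
    simp [DNOps.star, smul_add]

end StarAlg

/-- The augmented algebra `A₊ = k1 ⊕ A`, a unital associative algebra for the product `⋆̄`
extended by `x ⋆̄ 1 = x = 1 ⋆̄ x`. -/
abbrev Aug {k : Type u} {A : Type v} [Field k] [AddCommGroup A] [Module k A]
    {o : DNOps k A} (h : IsDendNij o) := Unitization k (StarAlg h)

namespace Aug

variable {k : Type u} {A : Type v} [Field k] [AddCommGroup A] [Module k A]
  {o : DNOps k A} (h : IsDendNij o)

/-- The inclusion `A → A₊`. -/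
def incl : A →ₗ[k] Aug h := Unitization.inrHom k k (StarAlg h) ∘ₗ (StarAlg.of h).toLinearMap

/-- The projection `A₊ → A`. -/
def proj : Aug h →ₗ[k] A := (StarAlg.of h).symm.toLinearMap ∘ₗ Unitization.sndHom k k (StarAlg h)

end Aug

/-! ### The unit action and the tensor product of two augmented algebras -/

/-- `x ↖ 1 = x`, and `x ⋄ 1 = 0` for the other operations. -/
def DNOp.rightUnit (k : Type u) [Field k] : DNOp → k
  | .nw => 1
  | _ => 0

/-- `1 ↘ x = x`, and `1 ⋄ x = 0` for the other operations. -/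
def DNOp.leftUnit (k : Type u) [Field k] : DNOp → k
  | .se => 1
  | _ => 0

section Tensor

variable {k : Type u} {A : Type v} {B : Type w} [Field k] [AddCommGroup A] [Module k A]
  [AddCommGroup B] [Module k B] {oA : DNOps k A} {oB : DNOps k B}

/-- The operations of `A` extended to `A₊` by the unit action. The expression `1 ⋄ 1` has no
meaning; it is given the value `0`, which never matters on `augTensor` below. -/
def extOp (hA : IsDendNij oA) (c : DNOp) : Aug hA →ₗ[k] Aug hA →ₗ[k] Aug hA :=
  LinearMap.mk₂ k
    (fun x y => Aug.incl hA (oA c (Aug.proj hA x) (Aug.proj hA y)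
      + (c.rightUnit k * y.fst) • Aug.proj hA x + (c.leftUnit k * x.fst) • Aug.proj hA y))
    (fun x x' y => by
      rw [← map_add]; congr 1
      simp only [map_add, LinearMap.add_apply, Unitization.fst_add]; module)
    (fun r x y => by
      rw [← map_smul (Aug.incl hA)]; congr 1
      simp only [map_smul, LinearMap.smul_apply, Unitization.fst_smul, smul_eq_mul]; module)
    (fun x y y' => by
      rw [← map_add]; congr 1
      simp only [map_add, Unitization.fst_add]; module)
    (fun r x y => by
      rw [← map_smul (Aug.incl hA)]; congr 1
      simp only [map_smul, Unitization.fst_smul, smul_eq_mul]; module)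

theorem extOp_incl_incl (hA : IsDendNij oA) (c : DNOp) (x y : A) :
    extOp hA c (Aug.incl hA x) (Aug.incl hA y) = Aug.incl hA (oA c x y) := by
  simp [extOp, Aug.incl, Aug.proj]

theorem extOp_incl_one (hA : IsDendNij oA) (c : DNOp) (x : A) :
    extOp hA c (Aug.incl hA x) 1 = c.rightUnit k • Aug.incl hA x := by
  simp [extOp, Aug.incl, Aug.proj]

theorem extOp_one_incl (hA : IsDendNij oA) (c : DNOp) (x : A) :
    extOp hA c 1 (Aug.incl hA x) = c.leftUnit k • Aug.incl hA x := by
  simp [extOp, Aug.incl, Aug.proj]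

theorem extOp_one_one (hA : IsDendNij oA) (c : DNOp) : extOp hA c 1 1 = 0 := by
  simp [extOp, Aug.incl, Aug.proj]

/-- The bilinear map `(b, b') ↦ ε(b) ε(b') 1` on `B₊`, where `ε` is the projection to `k`. -/
def unitPart (hB : IsDendNij oB) : Aug hB →ₗ[k] Aug hB →ₗ[k] Aug hB :=
  LinearMap.mk₂ k (fun x y => (x.fst * y.fst) • (1 : Aug hB))
    (fun x x' y => by simp only [Unitization.fst_add]; module)
    (fun r x y => by simp only [Unitization.fst_smul, smul_eq_mul]; module)
    (fun x y y' => by simp only [Unitization.fst_add]; module)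
    (fun r x y => by simp only [Unitization.fst_smul, smul_eq_mul]; module)

/-- The operations on `A₊ ⊗ B₊`:
`(a ⊗ b) ⋄ (a' ⊗ b') = (a ⋆̄ a') ⊗ (b ⋄ b')` if one of `b`, `b'` lies in `B`, and
`(a ⊗ 1) ⋄ (a' ⊗ 1) = (a ⋄ a') ⊗ 1` (see the three lemmas that follow). -/
noncomputable def tensorOp (hA : IsDendNij oA) (hB : IsDendNij oB) (c : DNOp) :
    Aug hA ⊗[k] Aug hB →ₗ[k] Aug hA ⊗[k] Aug hB →ₗ[k] Aug hA ⊗[k] Aug hB :=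
  TensorProduct.map₂ (LinearMap.mul k (Aug hA)) (extOp hB c)
    + TensorProduct.map₂ (extOp hA c) (unitPart hB)

theorem tensorOp_left (hA : IsDendNij oA) (hB : IsDendNij oB) (c : DNOp) (a a' : Aug hA) (b : B)
    (b' : Aug hB) : tensorOp hA hB c (a ⊗ₜ Aug.incl hB b) (a' ⊗ₜ b')
      = (a * a') ⊗ₜ extOp hB c (Aug.incl hB b) b' := by
  simp [tensorOp, unitPart, Aug.incl]

theorem tensorOp_right (hA : IsDendNij oA) (hB : IsDendNij oB) (c : DNOp) (a a' : Aug hA)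
    (b : Aug hB) (b' : B) : tensorOp hA hB c (a ⊗ₜ b) (a' ⊗ₜ Aug.incl hB b')
      = (a * a') ⊗ₜ extOp hB c b (Aug.incl hB b') := by
  simp [tensorOp, unitPart, Aug.incl]

theorem tensorOp_one_one (hA : IsDendNij oA) (hB : IsDendNij oB) (c : DNOp) (a a' : Aug hA) :
    tensorOp hA hB c (a ⊗ₜ 1) (a' ⊗ₜ 1) = extOp hA c a a' ⊗ₜ 1 := by
  simp [tensorOp, unitPart, extOp_one_one]

/-- The subspace `A ⊗ k1 ⊕ k1 ⊗ B ⊕ A ⊗ B` of `A₊ ⊗ B₊`. -/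
def augTensor (hA : IsDendNij oA) (hB : IsDendNij oB) : Submodule k (Aug hA ⊗[k] Aug hB) :=
  Submodule.span k
    ({t | ∃ a : A, t = Aug.incl hA a ⊗ₜ 1} ∪ {t | ∃ b : B, t = 1 ⊗ₜ Aug.incl hB b}
      ∪ {t | ∃ (a : A) (b : B), t = Aug.incl hA a ⊗ₜ Aug.incl hB b})

end Tensor

/-! ### Connected Hopf algebras -/

section Hopf

variable {k : Type u} {H : Type v} [Field k] [Ring H] [Algebra k H]

/-- The coproduct `Δ` and the counit `ε` make the algebra `H` a Hopf algebra. -/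
def IsHopf (Δ : H →ₐ[k] H ⊗[k] H) (ε : H →ₐ[k] k) : Prop :=
  ∃ h₁ h₂ h₃, ∃ S : HopfAlgebra k H, S.toBialgebra = Bialgebra.ofAlgHom Δ ε h₁ h₂ h₃

/-- `x ↦ Δ(x) - 1 ⊗ x - x ⊗ 1` -/
noncomputable def reducedComul (Δ : H →ₐ[k] H ⊗[k] H) : H →ₗ[k] H ⊗[k] H :=
  Δ.toLinearMap - TensorProduct.mk k H H 1 - (TensorProduct.mk k H H).flip 1

/-- `F₀ = k1` and `Fᵣ₊₁ = {x | Δ(x) - 1 ⊗ x - x ⊗ 1 ∈ Fᵣ ⊗ Fᵣ}`. -/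
noncomputable def connFiltration (Δ : H →ₐ[k] H ⊗[k] H) : ℕ → Submodule k H
  | 0 => Submodule.span k {1}
  | r + 1 => (LinearMap.range (TensorProduct.map (connFiltration Δ r).subtype
      (connFiltration Δ r).subtype)).comap (reducedComul Δ)

/-- `H` is the union of an increasing filtration `(Fᵣ)` as above. -/
def IsConnectedComul (Δ : H →ₐ[k] H ⊗[k] H) : Prop :=
  Monotone (connFiltration Δ) ∧ ∀ x, ∃ r, x ∈ connFiltration Δ r

end Hopf

/-- The augmented algebra `F₊` of a dendriform-Nijenhuis algebra `F` generated by `i : V → F`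
carries a connected Hopf algebra structure whose product is `⋆̄`, whose counit is the projection
onto `k1`, whose coproduct is a morphism of (augmented) dendriform-Nijenhuis algebras, and
for which the elements of `V` are primitive. -/
def HasConnectedHopf {k : Type u} {V : Type v} {F : Type w} [Field k] [AddCommGroup V]
    [Module k V] [AddCommGroup F] [Module k F] {o : DNOps k F} (h : IsDendNij o)
    (i : V →ₗ[k] F) : Prop :=
  ∃ (Δ : Aug h →ₐ[k] Aug h ⊗[k] Aug h) (ε : Aug h →ₐ[k] k),
    IsHopf Δ ε ∧ IsConnectedComul Δ ∧ (∀ x, ε x = x.fst) ∧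
    (∀ v, Δ (Aug.incl h (i v)) = 1 ⊗ₜ Aug.incl h (i v) + Aug.incl h (i v) ⊗ₜ 1) ∧
    (∀ x, Δ (Aug.incl h x) ∈ augTensor h h) ∧
    ∀ c x y, Δ (Aug.incl h (o c x y))
      = tensorOp h h c (Δ (Aug.incl h x)) (Δ (Aug.incl h y))

/-!
Each of the 28 relations has the form `∑ (x c y) d z = ∑ x c (y d z)`, hence is determined by two
sets of pairs `(c, d)` of operations. Since `1 ↘ x = x = x ↖ 1` are the only nonzero unit actions,
whether such a relation survives replacing some of its variables by `1` depends only on which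
pairs containing `↘` or `↖` occur in it (Loday's criterion). This finite check gives all relations
on the generators of `A ⊠ B`.

For a free algebra `F`, the map `v ↦ 1 ⊗ v + v ⊗ 1` therefore extends to a morphism
`δ : F → F ⊠ F`, and `δ` extends to an algebra morphism `Δ` on `F₊` because `⋆̄` on `F ⊠ F` is the
product of `F₊ ⊗ F₊`. Both sides of coassociativity and of the counit laws respect the nine
operations, so it suffices to compare them on `V`. As `Δ` respects the operations, these satisfy
`Fᵣ ⋄ Fₛ ⊆ Fᵣ₊ₛ`; the elements of `V` lie in `F₁`, so the filtration is exhaustive. The antipode is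
the convolution inverse of the identity, a geometric series that is finite on each `Fᵣ`.
-/

/-! ### The relations as data -/

instance : DecidableEq DNOp := fun c d =>
  decidable_of_iff (c.ctorIdx = d.ctorIdx)
    ⟨fun h => by cases c <;> cases d <;> (first | rfl | (cases h)), congrArg _⟩

instance : Fintype DNOp where
  elems := {.ne, .se, .sw, .nw, .up, .dn, .pre, .suc, .bul}
  complete c := by cases c <;> decide

namespace DNOp

/-- The operations that sum to `◁`. -/
def lts : Finset DNOp := {nw, sw, pre}

/-- The operations that sum to `▷`. -/
def rts : Finset DNOp := {ne, se, suc}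

/-- The operations that sum to `•̄`. -/
def bbs : Finset DNOp := {up, dn, bul}

/-- The operations that sum to `∧`. -/
def wes : Finset DNOp := {nw, ne, up}

/-- The operations that sum to `∨`. -/
def ves : Finset DNOp := {se, sw, dn}

/-- The operations that sum to `⋆̃`. -/
def tss : Finset DNOp := {pre, suc, bul}

/-- A relation `∑ (x c y) d z = ∑ x c (y d z)`, given by the pairs `(c, d)` that occur on each
side. -/
structure Relation where
  /-- The pairs `(c, d)` for which `(x c y) d z` occurs on the left. -/
  left : Finset (DNOp × DNOp)
  /-- The pairs `(c, d)` for which `x c (y d z)` occurs on the right. -/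
  right : Finset (DNOp × DNOp)

open Finset in
/-- The 28 relations of a dendriform-Nijenhuis algebra, in the order of `IsDendNij`. -/
def relations : List Relation :=
  [⟨{(nw, nw)}, {nw} ×ˢ univ⟩,
   ⟨{(ne, nw)}, {ne} ×ˢ lts⟩,
   ⟨wes ×ˢ {ne}, {ne} ×ˢ rts⟩,
   ⟨{(sw, nw)}, {sw} ×ˢ wes⟩,
   ⟨{(se, nw)}, {(se, nw)}⟩,
   ⟨ves ×ˢ {ne}, {(se, ne)}⟩,
   ⟨lts ×ˢ {sw}, {sw} ×ˢ ves⟩,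
   ⟨rts ×ˢ {sw}, {(se, sw)}⟩,
   ⟨univ ×ˢ {se}, {(se, se)}⟩,
   ⟨{(sw, pre)}, {sw} ×ˢ tss⟩,
   ⟨{(se, pre)}, {(se, pre)}⟩,
   ⟨ves ×ˢ {suc}, {(se, suc)}⟩,
   ⟨{(nw, pre)}, {pre} ×ˢ ves⟩,
   ⟨{(ne, pre)}, {(suc, sw)}⟩,
   ⟨wes ×ˢ {suc}, {(suc, se)}⟩,
   ⟨{(pre, nw)}, {pre} ×ˢ wes⟩,
   ⟨{(suc, nw)}, {(suc, nw)}⟩,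
   ⟨tss ×ˢ {ne}, {(suc, ne)}⟩,
   ⟨{(pre, pre)}, {pre} ×ˢ tss⟩,
   ⟨{(suc, pre)}, {(suc, pre)}⟩,
   ⟨tss ×ˢ {suc}, {(suc, suc)}⟩,
   ⟨wes ×ˢ {up} ∪ {(up, nw)}, {ne} ×ˢ bbs ∪ {up} ×ˢ univ⟩,
   ⟨ves ×ˢ {up} ∪ {(dn, nw)}, {(se, up)} ∪ {dn} ×ˢ wes⟩,
   ⟨univ ×ˢ {dn} ∪ bbs ×ˢ {sw}, {(se, dn)} ∪ {dn} ×ˢ ves⟩,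
   ⟨ves ×ˢ {bul} ∪ {(dn, pre)}, {(se, bul)} ∪ {dn} ×ˢ tss⟩,
   ⟨wes ×ˢ {bul} ∪ {(up, pre)}, {(suc, dn)} ∪ {bul} ×ˢ ves⟩,
   ⟨tss ×ˢ {up} ∪ {(bul, nw)}, {(suc, up)} ∪ {bul} ×ˢ wes⟩,
   ⟨tss ×ˢ {bul} ∪ {(bul, pre)}, {(suc, bul)} ∪ {bul} ×ˢ tss⟩]

end DNOp

namespace DNOps

variable {k : Type u} {A : Type v} [Field k] [AddCommGroup A] [Module k A] (o : DNOps k A)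

theorem lt_eq_sum (x y : A) : o.lt x y = ∑ c ∈ DNOp.lts, o c x y := by
  simp [lt, DNOp.lts, add_assoc]

theorem rt_eq_sum (x y : A) : o.rt x y = ∑ c ∈ DNOp.rts, o c x y := by
  simp [rt, DNOp.rts, add_assoc]

theorem bb_eq_sum (x y : A) : o.bb x y = ∑ c ∈ DNOp.bbs, o c x y := by
  simp [bb, DNOp.bbs, add_assoc]

theorem we_eq_sum (x y : A) : o.we x y = ∑ c ∈ DNOp.wes, o c x y := by
  simp [we, DNOp.wes, add_assoc]

theorem ve_eq_sum (x y : A) : o.ve x y = ∑ c ∈ DNOp.ves, o c x y := by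
  simp [ve, DNOp.ves, add_assoc]

theorem ts_eq_sum (x y : A) : o.ts x y = ∑ c ∈ DNOp.tss, o c x y := by
  simp [ts, DNOp.tss, add_assoc]

theorem star_eq_sum (x y : A) : o.star x y = ∑ c, o c x y := by
  have univ_eq : (Finset.univ : Finset DNOp) =
      {.ne, .se, .sw, .nw, .up, .dn, .pre, .suc, .bul} := rfl
  simp [star, univ_eq, add_assoc]

end DNOps

/-- The relation `r` holds for the operations `o` at `(x, y, z)`. -/
def DNOp.Relation.HoldsAt {k : Type u} {A : Type v} [Field k] [AddCommGroup A] [Module k A]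
    (r : DNOp.Relation) (o : DNOps k A) (x y z : A) : Prop :=
  ∑ p ∈ r.left, o p.2 (o p.1 x y) z = ∑ p ∈ r.right, o p.1 x (o p.2 y z)

theorem isDendNij_iff {k : Type u} {A : Type v} [Field k] [AddCommGroup A] [Module k A]
    {o : DNOps k A} : IsDendNij o ↔
      ∀ r ∈ DNOp.relations, ∀ x y z, r.HoldsAt o x y z := by
  simp (disch := decide) only [DNOp.relations, List.forall_mem_cons, DNOp.Relation.HoldsAt,
    Finset.sum_union, Finset.sum_product, Finset.sum_singleton]
  constructor
  · rintro ⟨⟩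
    simp only [DNOps.star_eq_sum, DNOps.lt_eq_sum, DNOps.rt_eq_sum, DNOps.bb_eq_sum,
      DNOps.we_eq_sum, DNOps.ve_eq_sum, DNOps.ts_eq_sum, map_sum, LinearMap.sum_apply] at *
    simp only [List.not_mem_nil, false_implies, implies_true, and_true]
    and_intros <;> assumption
  · rintro ⟨_, _, _, _, _, _, _, _, _, _, _, _, _, _, _, _, _, _, _, _, _, _, _, _, _, _, _, _, -⟩
    constructor <;>
      simpa only [DNOps.star_eq_sum, DNOps.lt_eq_sum, DNOps.rt_eq_sum, DNOps.bb_eq_sum,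
        DNOps.we_eq_sum, DNOps.ve_eq_sum, DNOps.ts_eq_sum, map_sum, LinearMap.sum_apply]

/-! ### Loday's coherence criterion -/

namespace DNOp

variable (k : Type u) [Field k]

theorem leftUnit_eq_single : leftUnit k = Pi.single se 1 := by
  ext c; cases c <;> rfl

theorem rightUnit_eq_single : rightUnit k = Pi.single nw 1 := by
  ext c; cases c <;> rfl

theorem leftUnit_eq_rightUnit_opp (c : DNOp) : c.leftUnit k = c.opp.rightUnit k := by
  cases c <;> rfl

theorem opp_opp (c : DNOp) : c.opp.opp = c := by cases c <;> rfl

/-- A relation is coherent with the unit action if it remains valid when some of its variables,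
but not all of them, are replaced by `1`; the first three conditions come from one unit, the last
two from two units. -/
structure Relation.IsCoherent (r : Relation) : Prop where
  one_fst : ∀ d, (se, d) ∈ r.left ↔ (se, d) ∈ r.right
  one_snd : ∀ d, (nw, d) ∈ r.left ↔ (d, se) ∈ r.right
  one_thd : ∀ c, (c, nw) ∈ r.left ↔ (c, nw) ∈ r.right
  one_fst_snd : ∀ c, (c, se) ∈ r.left ↔ (se, se) ∈ r.right
  one_snd_thd : ∀ d, (nw, nw) ∈ r.left ↔ (nw, d) ∈ r.right

theorem isCoherent_of_mem_relations : ∀ r ∈ relations, r.IsCoherent := fun _ hr =>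
  ⟨by decide +revert, by decide +revert, by decide +revert, by decide +revert, by decide +revert⟩

end DNOp

/-! ### Coherence of the unit action -/

section Span

variable {R M N : Type*} [CommSemiring R] [AddCommMonoid M] [Module R M] [AddCommMonoid N]
  [Module R N] {s : Set M}

theorem bilinear_eqOn_span {f g : M →ₗ[R] M →ₗ[R] N} (h : ∀ x ∈ s, ∀ y ∈ s, f x y = g x y) :
    ∀ x ∈ Submodule.span R s, ∀ y ∈ Submodule.span R s, f x y = g x y := fun _ hx y hy =>
  LinearMap.eqOn_span (f := f.flip y) (g := g.flip y)
    (fun _ hx => LinearMap.eqOn_span (h _ hx) hy) hx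

theorem trilinear_eqOn_span {f g : M →ₗ[R] M →ₗ[R] M →ₗ[R] N}
    (h : ∀ x ∈ s, ∀ y ∈ s, ∀ z ∈ s, f x y z = g x y z) :
    ∀ x ∈ Submodule.span R s, ∀ y ∈ Submodule.span R s, ∀ z ∈ Submodule.span R s,
      f x y z = g x y z := fun _ hx y hy z hz =>
  LinearMap.eqOn_span (f := LinearMap.applyₗ z ∘ₗ f.flip y) (g := LinearMap.applyₗ z ∘ₗ g.flip y)
    (fun _ hx => bilinear_eqOn_span (h _ hx) y hy z hz) hx

end Span

section SumPi

variable {R M ι κ : Type*} [Semiring R] [AddCommMonoid M] [Module R M] [DecidableEq ι]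
  [DecidableEq κ] (s : Finset (ι × κ))

theorem sum_single_fst_smul [Fintype κ] (i : ι) (f : ι × κ → M) :
    ∑ p ∈ s, (Pi.single i 1 : ι → R) p.1 • f p = ∑ j, if (i, j) ∈ s then f (i, j) else 0 := by
  simp only [← Finset.sum_ite_eq s, Pi.single_apply, ite_smul, one_smul, zero_smul]
  rw [Finset.sum_comm]
  refine Finset.sum_congr rfl fun p _ => ?_
  simp [Prod.ext_iff, ite_and, eq_comm]

theorem sum_single_snd_smul [Fintype ι] (j : κ) (f : ι × κ → M) :
    ∑ p ∈ s, (Pi.single j 1 : κ → R) p.2 • f p = ∑ i, if (i, j) ∈ s then f (i, j) else 0 := by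
  simp only [← Finset.sum_ite_eq s, Pi.single_apply, ite_smul, one_smul, zero_smul]
  rw [Finset.sum_comm]
  refine Finset.sum_congr rfl fun p _ => ?_
  simp [Prod.ext_iff, ite_and, eq_comm]

theorem sum_single_fst_smul_single_snd_smul (i : ι) (j : κ) (m : M) :
    ∑ p ∈ s, (Pi.single i 1 : ι → R) p.1 • (Pi.single j 1 : κ → R) p.2 • m =
      if (i, j) ∈ s then m else 0 := by
  rw [← Finset.sum_ite_eq' s (i, j) fun _ => m]
  refine Finset.sum_congr rfl fun p _ => ?_
  by_cases hi : p.1 = i <;> by_cases hj : p.2 = j <;> simp [Prod.ext_iff, hi, hj]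

theorem sum_single_snd_smul_single_fst_smul (i : ι) (j : κ) (m : M) :
    ∑ p ∈ s, (Pi.single j 1 : κ → R) p.2 • (Pi.single i 1 : ι → R) p.1 • m =
      if (i, j) ∈ s then m else 0 := by
  rw [← Finset.sum_ite_eq' s (i, j) fun _ => m]
  refine Finset.sum_congr rfl fun p _ => ?_
  by_cases hi : p.1 = i <;> by_cases hj : p.2 = j <;> simp [Prod.ext_iff, hi, hj]

end SumPi

namespace DNOp.Relation

variable {k : Type u} {M : Type v} [Field k] [AddCommGroup M] [Module k M] {r : Relation}
  {o : DNOps k M}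

theorem holdsAt_span {s : Set M} (h : ∀ x ∈ s, ∀ y ∈ s, ∀ z ∈ s, r.HoldsAt o x y z) :
    ∀ x ∈ Submodule.span k s, ∀ y ∈ Submodule.span k s, ∀ z ∈ Submodule.span k s,
      r.HoldsAt o x y z := by
  let lhs : M →ₗ[k] M →ₗ[k] M →ₗ[k] M := ∑ p ∈ r.left, (o p.1).compr₂ (o p.2)
  let rhs : M →ₗ[k] M →ₗ[k] M →ₗ[k] M :=
    ∑ p ∈ r.right, (LinearMap.llcomp k M M M).compl₁₂ (o p.1) (o p.2)
  have holdsAt_iff (x y z : M) : r.HoldsAt o x y z ↔ lhs x y z = rhs x y z := by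
    simp [HoldsAt, lhs, rhs, LinearMap.sum_apply]
  simp only [holdsAt_iff] at h ⊢
  exact trilinear_eqOn_span h

end DNOp.Relation

namespace DNOps

variable {k : Type u} {M : Type v} [Field k] [AddCommGroup M] [Module k M] (o : DNOps k M)
  (p : Submodule k M)

/-- The operations that a subspace closed under them inherits. -/
def restrict (hp : ∀ c, ∀ x ∈ p, ∀ y ∈ p, o c x y ∈ p) : DNOps k p := fun c =>
  LinearMap.mk₂ k (fun x y => ⟨o c x y, hp c x x.2 y y.2⟩)
    (fun x x' y => by ext; simp) (fun r x y => by ext; simp)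
    (fun x y y' => by ext; simp) (fun r x y => by ext; simp)

variable {o p} {hp : ∀ c, ∀ x ∈ p, ∀ y ∈ p, o c x y ∈ p}

theorem coe_restrict (c : DNOp) (x y : p) : (o.restrict p hp c x y : M) = o c x y := rfl

theorem isDendNij_restrict (h : ∀ r ∈ DNOp.relations, ∀ x ∈ p, ∀ y ∈ p, ∀ z ∈ p,
    r.HoldsAt o x y z) : IsDendNij (o.restrict p hp) := by
  refine isDendNij_iff.2 fun r hr x y z => Subtype.ext ?_
  simpa only [DNOp.Relation.HoldsAt, AddSubmonoidClass.coe_finsetSum, coe_restrict] using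
    h r hr x x.2 y y.2 z z.2

theorem isCommDN_restrict (h : ∀ c, ∀ x ∈ p, ∀ y ∈ p, o c x y = o c.opp y x) :
    IsCommDN (o.restrict p hp) := fun c x y => Subtype.ext (h c x x.2 y y.2)

end DNOps

section Coherence

variable {k : Type u} {A : Type v} {B : Type w} [Field k] [AddCommGroup A] [Module k A]
  [AddCommGroup B] [Module k B] {oA : DNOps k A} {oB : DNOps k B}

namespace Aug

theorem incl_mul_incl (hA : IsDendNij oA) (x y : A) :
    incl hA x * incl hA y = incl hA (oA.star x y) := by
  simp only [incl, LinearMap.comp_apply, LinearEquiv.coe_coe, Unitization.inrHom_apply,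
    ← Unitization.inr_mul, StarAlg.of_mul_of]

theorem incl_mul_incl_eq_sum (hA : IsDendNij oA) (x y : A) :
    incl hA x * incl hA y = ∑ c, incl hA (oA c x y) := by
  rw [incl_mul_incl, DNOps.star_eq_sum, map_sum]

theorem fst_smul_one_add_incl_proj (hA : IsDendNij oA) (x : Aug hA) :
    x.fst • 1 + incl hA (proj hA x) = x := by
  ext <;> simp [incl, proj]

end Aug

variable (hA : IsDendNij oA) (hB : IsDendNij oB)

/-- A generating set of `augTensor` on which `tensorOp` is given by four formulas. -/
def augTensorGen : Set (Aug hA ⊗[k] Aug hB) :=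
  {t | (∃ a, t = Aug.incl hA a ⊗ₜ 1) ∨ ∃ a b, t = a ⊗ₜ Aug.incl hB b}

theorem augTensor_eq_span : augTensor hA hB = Submodule.span k (augTensorGen hA hB) := by
  refine le_antisymm (Submodule.span_le.2 ?_) (Submodule.span_le.2 ?_)
  · rintro t ((⟨a, rfl⟩ | ⟨b, rfl⟩) | ⟨a, b, rfl⟩)
    · exact Submodule.subset_span (.inl ⟨a, rfl⟩)
    · exact Submodule.subset_span (.inr ⟨1, b, rfl⟩)
    · exact Submodule.subset_span (.inr ⟨_, b, rfl⟩)
  · rintro t (⟨a, rfl⟩ | ⟨a, b, rfl⟩)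
    · exact Submodule.subset_span (.inl (.inl ⟨a, rfl⟩))
    · rw [← Aug.fst_smul_one_add_incl_proj hA a, TensorProduct.add_tmul,
        ← TensorProduct.smul_tmul']
      exact add_mem (Submodule.smul_mem _ _ (Submodule.subset_span (.inl (.inr ⟨b, rfl⟩))))
        (Submodule.subset_span (.inr ⟨_, b, rfl⟩))

theorem incl_tmul_one_mem_augTensor (a : A) : Aug.incl hA a ⊗ₜ 1 ∈ augTensor hA hB :=
  Submodule.subset_span (.inl (.inl ⟨a, rfl⟩))

theorem tmul_incl_mem_augTensor (a : Aug hA) (b : B) : a ⊗ₜ Aug.incl hB b ∈ augTensor hA hB :=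
  augTensor_eq_span hA hB ▸ Submodule.subset_span (.inr ⟨a, b, rfl⟩)

section Formulas

variable (c : DNOp)

theorem tensorOp_incl_one_incl_one (a a' : A) :
    tensorOp hA hB c (Aug.incl hA a ⊗ₜ 1) (Aug.incl hA a' ⊗ₜ 1) =
      Aug.incl hA (oA c a a') ⊗ₜ 1 := by
  rw [tensorOp_one_one, extOp_incl_incl]

theorem tensorOp_tmul_one_tmul_incl (a a' : Aug hA) (b : B) :
    tensorOp hA hB c (a ⊗ₜ 1) (a' ⊗ₜ Aug.incl hB b) =
      c.leftUnit k • (a * a') ⊗ₜ Aug.incl hB b := by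
  rw [tensorOp_right, extOp_one_incl, TensorProduct.tmul_smul]

theorem tensorOp_tmul_incl_tmul_one (a a' : Aug hA) (b : B) :
    tensorOp hA hB c (a ⊗ₜ Aug.incl hB b) (a' ⊗ₜ 1) =
      c.rightUnit k • (a * a') ⊗ₜ Aug.incl hB b := by
  rw [tensorOp_left, extOp_incl_one, TensorProduct.tmul_smul]

theorem tensorOp_tmul_incl_tmul_incl (a a' : Aug hA) (b b' : B) :
    tensorOp hA hB c (a ⊗ₜ Aug.incl hB b) (a' ⊗ₜ Aug.incl hB b') =
      (a * a') ⊗ₜ Aug.incl hB (oB c b b') := by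
  rw [tensorOp_left, extOp_incl_incl]

end Formulas

theorem tensorOp_mem_augTensor (c : DNOp) :
    ∀ x ∈ augTensor hA hB, ∀ y ∈ augTensor hA hB, tensorOp hA hB c x y ∈ augTensor hA hB := by
  suffices Submodule.map₂ (tensorOp hA hB c) (augTensor hA hB) (augTensor hA hB) ≤
      augTensor hA hB from fun x hx y hy => this (Submodule.apply_mem_map₂ _ hx hy)
  rw [augTensor_eq_span, Submodule.map₂_span_span, Submodule.span_le, ← augTensor_eq_span]
  rintro _ ⟨_, ⟨a, rfl⟩ | ⟨a, b, rfl⟩, _, ⟨a', rfl⟩ | ⟨a', b', rfl⟩, rfl⟩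
  · simpa only [SetLike.mem_coe, tensorOp_incl_one_incl_one] using
      incl_tmul_one_mem_augTensor hA hB _
  · simpa only [SetLike.mem_coe, tensorOp_tmul_one_tmul_incl] using
      Submodule.smul_mem _ _ (tmul_incl_mem_augTensor hA hB _ _)
  · simpa only [SetLike.mem_coe, tensorOp_tmul_incl_tmul_one] using
      Submodule.smul_mem _ _ (tmul_incl_mem_augTensor hA hB _ _)
  · simpa only [SetLike.mem_coe, tensorOp_tmul_incl_tmul_incl] using
      tmul_incl_mem_augTensor hA hB _ _

/-- The operations of `A ⊠ B`. -/
noncomputable def augTensorOps : DNOps k (augTensor hA hB) :=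
  DNOps.restrict (tensorOp hA hB) (augTensor hA hB) (tensorOp_mem_augTensor hA hB)

section Relations

variable {r : DNOp.Relation}

theorem holdsAt_tensorOp_incl_tmul_one (hr : r ∈ DNOp.relations) (a a' a'' : A) :
    r.HoldsAt (tensorOp hA hB) (Aug.incl hA a ⊗ₜ 1) (Aug.incl hA a' ⊗ₜ 1)
      (Aug.incl hA a'' ⊗ₜ 1) := by
  simpa only [DNOp.Relation.HoldsAt, tensorOp_incl_one_incl_one, map_sum, TensorProduct.sum_tmul]
    using congrArg (fun t => Aug.incl hA t ⊗ₜ[k] (1 : Aug hB)) (isDendNij_iff.1 hA r hr a a' a'')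

theorem holdsAt_tensorOp_tmul_incl (hr : r ∈ DNOp.relations) (a a' a'' : Aug hA) (b b' b'' : B) :
    r.HoldsAt (tensorOp hA hB) (a ⊗ₜ Aug.incl hB b) (a' ⊗ₜ Aug.incl hB b')
      (a'' ⊗ₜ Aug.incl hB b'') := by
  simpa only [DNOp.Relation.HoldsAt, tensorOp_tmul_incl_tmul_incl, map_sum,
    TensorProduct.tmul_sum, mul_assoc] using
    congrArg (fun t => (a * a' * a'') ⊗ₜ[k] Aug.incl hB t) (isDendNij_iff.1 hB r hr b b' b'')

variable (hr : r.IsCoherent)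

include hr

theorem holdsAt_tensorOp_one_fst (a a' a'' : Aug hA) (b' b'' : B) :
    r.HoldsAt (tensorOp hA hB) (a ⊗ₜ 1) (a' ⊗ₜ Aug.incl hB b') (a'' ⊗ₜ Aug.incl hB b'') := by
  simp only [DNOp.Relation.HoldsAt, tensorOp_tmul_one_tmul_incl, tensorOp_tmul_incl_tmul_incl,
    map_smul, LinearMap.smul_apply, DNOp.leftUnit_eq_single, sum_single_fst_smul, hr.one_fst,
    mul_assoc]

theorem holdsAt_tensorOp_one_snd (a a' a'' : Aug hA) (b b'' : B) :
    r.HoldsAt (tensorOp hA hB) (a ⊗ₜ Aug.incl hB b) (a' ⊗ₜ 1) (a'' ⊗ₜ Aug.incl hB b'') := by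
  simp only [DNOp.Relation.HoldsAt, tensorOp_tmul_one_tmul_incl, tensorOp_tmul_incl_tmul_one,
    tensorOp_tmul_incl_tmul_incl, map_smul, LinearMap.smul_apply, DNOp.leftUnit_eq_single,
    DNOp.rightUnit_eq_single, sum_single_fst_smul, sum_single_snd_smul, hr.one_snd, mul_assoc]

theorem holdsAt_tensorOp_one_thd (a a' a'' : Aug hA) (b b' : B) :
    r.HoldsAt (tensorOp hA hB) (a ⊗ₜ Aug.incl hB b) (a' ⊗ₜ Aug.incl hB b') (a'' ⊗ₜ 1) := by
  simp only [DNOp.Relation.HoldsAt, tensorOp_tmul_incl_tmul_one, tensorOp_tmul_incl_tmul_incl,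
    map_smul, DNOp.rightUnit_eq_single, sum_single_snd_smul, hr.one_thd, mul_assoc]

theorem holdsAt_tensorOp_one_fst_thd (a a' a'' : Aug hA) (b' : B) :
    r.HoldsAt (tensorOp hA hB) (a ⊗ₜ 1) (a' ⊗ₜ Aug.incl hB b') (a'' ⊗ₜ 1) := by
  simp only [DNOp.Relation.HoldsAt, tensorOp_tmul_one_tmul_incl, tensorOp_tmul_incl_tmul_one,
    map_smul, LinearMap.smul_apply, mul_assoc]
  rw [DNOp.leftUnit_eq_single, DNOp.rightUnit_eq_single, sum_single_fst_smul_single_snd_smul,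
    sum_single_snd_smul_single_fst_smul]
  simp only [hr.one_fst]

theorem holdsAt_tensorOp_one_fst_snd (a a' : A) (a'' : Aug hA) (b'' : B) :
    r.HoldsAt (tensorOp hA hB) (Aug.incl hA a ⊗ₜ 1) (Aug.incl hA a' ⊗ₜ 1)
      (a'' ⊗ₜ Aug.incl hB b'') := by
  simp only [DNOp.Relation.HoldsAt, tensorOp_incl_one_incl_one, tensorOp_tmul_one_tmul_incl,
    map_smul, ← mul_assoc]
  rw [DNOp.leftUnit_eq_single, sum_single_snd_smul_single_fst_smul, sum_single_snd_smul]
  simp only [hr.one_fst_snd, Finset.sum_ite_irrel, Finset.sum_const_zero,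
    Aug.incl_mul_incl_eq_sum, Finset.sum_mul, TensorProduct.sum_tmul]

theorem holdsAt_tensorOp_one_snd_thd (a : Aug hA) (a' a'' : A) (b : B) :
    r.HoldsAt (tensorOp hA hB) (a ⊗ₜ Aug.incl hB b) (Aug.incl hA a' ⊗ₜ 1)
      (Aug.incl hA a'' ⊗ₜ 1) := by
  simp only [DNOp.Relation.HoldsAt, tensorOp_incl_one_incl_one, tensorOp_tmul_incl_tmul_one,
    map_smul, LinearMap.smul_apply, mul_assoc]
  rw [DNOp.rightUnit_eq_single, sum_single_fst_smul_single_snd_smul, sum_single_fst_smul]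
  simp only [← hr.one_snd_thd, Finset.sum_ite_irrel, Finset.sum_const_zero,
    Aug.incl_mul_incl_eq_sum, Finset.mul_sum, TensorProduct.sum_tmul]

end Relations

theorem isDendNij_augTensorOps : IsDendNij (augTensorOps hA hB) := by
  refine DNOps.isDendNij_restrict fun r hr => ?_
  have coherent := DNOp.isCoherent_of_mem_relations r hr
  rw [augTensor_eq_span]
  apply DNOp.Relation.holdsAt_span
  rintro _ (⟨a, rfl⟩ | ⟨a, b, rfl⟩) _ (⟨a', rfl⟩ | ⟨a', b', rfl⟩) _ (⟨a'', rfl⟩ | ⟨a'', b'', rfl⟩)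
  · exact holdsAt_tensorOp_incl_tmul_one hA hB hr a a' a''
  · exact holdsAt_tensorOp_one_fst_snd hA hB coherent a a' a'' b''
  · exact holdsAt_tensorOp_one_fst_thd hA hB coherent _ a' _ b'
  · exact holdsAt_tensorOp_one_fst hA hB coherent _ a' a'' b' b''
  · exact holdsAt_tensorOp_one_snd_thd hA hB coherent a a' a'' b
  · exact holdsAt_tensorOp_one_snd hA hB coherent a _ a'' b b''
  · exact holdsAt_tensorOp_one_thd hA hB coherent a a' _ b b'
  · exact holdsAt_tensorOp_tmul_incl hA hB hr a a' a'' b b' b''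

theorem coe_star_augTensorOps (x y : augTensor hA hB) :
    ((augTensorOps hA hB).star x y : Aug hA ⊗[k] Aug hB) = x * y := by
  suffices ∀ x ∈ augTensor hA hB, ∀ y ∈ augTensor hA hB,
      (∑ c, tensorOp hA hB c) x y = LinearMap.mul k _ x y by
    simpa [DNOps.star_eq_sum, augTensorOps, DNOps.coe_restrict, LinearMap.sum_apply] using
      this x x.2 y y.2
  rw [augTensor_eq_span]
  apply bilinear_eqOn_span
  rintro _ (⟨a, rfl⟩ | ⟨a, b, rfl⟩) _ (⟨a', rfl⟩ | ⟨a', b', rfl⟩) <;>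
    simp [LinearMap.sum_apply, tensorOp_incl_one_incl_one, tensorOp_tmul_one_tmul_incl,
      tensorOp_tmul_incl_tmul_one, tensorOp_tmul_incl_tmul_incl, DNOp.leftUnit_eq_single,
      DNOp.rightUnit_eq_single, Aug.incl_mul_incl_eq_sum, TensorProduct.sum_tmul,
      TensorProduct.tmul_sum, ← Finset.sum_smul]

theorem IsCommDN.star_comm (h : IsCommDN oA) (x y : A) : oA.star x y = oA.star y x := by
  rw [DNOps.star_eq_sum, DNOps.star_eq_sum]
  exact Fintype.sum_bijective DNOp.opp (Function.Involutive.bijective DNOp.opp_opp) _ _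
    fun c => h c x y

theorem IsCommDN.aug_mul_comm {hA : IsDendNij oA} (h : IsCommDN oA) (x y : Aug hA) :
    x * y = y * x := by
  rw [← Aug.fst_smul_one_add_incl_proj hA x, ← Aug.fst_smul_one_add_incl_proj hA y]
  simp only [mul_add, add_mul, Aug.incl_mul_incl, h.star_comm (Aug.proj hA y), smul_mul_assoc,
    mul_smul_comm, one_mul, mul_one]
  module

theorem isCommDN_augTensorOps (hA' : IsCommDN oA) (hB' : IsCommDN oB) :
    IsCommDN (augTensorOps hA hB) := by
  refine DNOps.isCommDN_restrict fun c => ?_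
  suffices ∀ x ∈ augTensor hA hB, ∀ y ∈ augTensor hA hB,
      tensorOp hA hB c x y = (tensorOp hA hB c.opp).flip x y from this
  rw [augTensor_eq_span]
  apply bilinear_eqOn_span
  rintro _ (⟨a, rfl⟩ | ⟨a, b, rfl⟩) _ (⟨a', rfl⟩ | ⟨a', b', rfl⟩) <;> rw [LinearMap.flip_apply]
  · rw [tensorOp_incl_one_incl_one, tensorOp_incl_one_incl_one, hA']
  · rw [tensorOp_tmul_one_tmul_incl, tensorOp_tmul_incl_tmul_one, hA'.aug_mul_comm,
      DNOp.leftUnit_eq_rightUnit_opp]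
  · rw [tensorOp_tmul_one_tmul_incl, tensorOp_tmul_incl_tmul_one, hA'.aug_mul_comm,
      DNOp.leftUnit_eq_rightUnit_opp, DNOp.opp_opp]
  · rw [tensorOp_tmul_incl_tmul_incl, tensorOp_tmul_incl_tmul_incl, hA'.aug_mul_comm, hB']

end Coherence

/-! ### Operations on tensor products -/

section BoxOp

variable {R A A' M M' : Type*} [CommSemiring R] [Semiring A] [Algebra R A] [Semiring A']
  [Algebra R A'] [AddCommMonoid M] [Module R M] [AddCommMonoid M'] [Module R M']

/-- The operation `(a ⊗ m) ⋄ (a' ⊗ m') = a a' ⊗ e₂ m m' + e₁ a a' ⊗ u m m'` on `A ⊗ M`. With `u`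
the projection to the unit component this is the operation of `⊠`, and unlike the latter it is
defined everywhere, so that it can be iterated. -/
noncomputable def boxOp (e₁ : A →ₗ[R] A →ₗ[R] A) (e₂ u : M →ₗ[R] M →ₗ[R] M) :
    A ⊗[R] M →ₗ[R] A ⊗[R] M →ₗ[R] A ⊗[R] M :=
  TensorProduct.map₂ (LinearMap.mul R A) e₂ + TensorProduct.map₂ e₁ u

variable (e₁ : A →ₗ[R] A →ₗ[R] A) (e₂ u : M →ₗ[R] M →ₗ[R] M)

theorem boxOp_tmul (a a' : A) (m m' : M) :
    boxOp e₁ e₂ u (a ⊗ₜ m) (a' ⊗ₜ m') = (a * a') ⊗ₜ e₂ m m' + e₁ a a' ⊗ₜ u m m' := rfl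

theorem assoc_boxOp (e₁' u' : A' →ₗ[R] A' →ₗ[R] A') (x y : (A ⊗[R] A') ⊗[R] M) :
    TensorProduct.assoc R A A' M (boxOp (boxOp e₁ e₁' u') e₂ u x y) =
      boxOp e₁ (boxOp e₁' e₂ u) (TensorProduct.map₂ u' u) (TensorProduct.assoc R A A' M x)
        (TensorProduct.assoc R A A' M y) := by
  suffices (boxOp (boxOp e₁ e₁' u') e₂ u).compr₂ (TensorProduct.assoc R A A' M).toLinearMap =
      (boxOp e₁ (boxOp e₁' e₂ u) (TensorProduct.map₂ u' u)).compl₁₂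
        (TensorProduct.assoc R A A' M).toLinearMap (TensorProduct.assoc R A A' M).toLinearMap
    from LinearMap.congr_fun₂ this x y
  ext
  simp [boxOp_tmul, TensorProduct.add_tmul, TensorProduct.tmul_add, add_assoc]

variable {e₁ e₂ u}

theorem map_boxOp {e₁' : A' →ₗ[R] A' →ₗ[R] A'} {e₂' u' : M' →ₗ[R] M' →ₗ[R] M'} {f : A →ₐ[R] A'}
    {g : M →ₗ[R] M'} (h₁ : ∀ a b, f (e₁ a b) = e₁' (f a) (f b))
    (h₂ : ∀ m n, g (e₂ m n) = e₂' (g m) (g n)) (hu : ∀ m n, g (u m n) = u' (g m) (g n))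
    (x y : A ⊗[R] M) :
    TensorProduct.map f.toLinearMap g (boxOp e₁ e₂ u x y) =
      boxOp e₁' e₂' u' (TensorProduct.map f.toLinearMap g x)
        (TensorProduct.map f.toLinearMap g y) := by
  suffices (boxOp e₁ e₂ u).compr₂ (TensorProduct.map f.toLinearMap g) =
      (boxOp e₁' e₂' u').compl₁₂ (TensorProduct.map f.toLinearMap g)
        (TensorProduct.map f.toLinearMap g)
    from LinearMap.congr_fun₂ this x y
  ext
  simp [boxOp_tmul, h₁, h₂, hu]

variable (e₁ e₂ u)

theorem lid_boxOp (x y : R ⊗[R] M) :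
    TensorProduct.lid R M (boxOp 0 e₂ u x y) =
      e₂ (TensorProduct.lid R M x) (TensorProduct.lid R M y) := by
  suffices (boxOp 0 e₂ u).compr₂ (TensorProduct.lid R M).toLinearMap =
      e₂.compl₁₂ (TensorProduct.lid R M).toLinearMap (TensorProduct.lid R M).toLinearMap
    from LinearMap.congr_fun₂ this x y
  ext
  simp [boxOp_tmul]

theorem rid_boxOp (x y : A ⊗[R] R) :
    TensorProduct.rid R A (boxOp e₁ 0 (LinearMap.mul R R) x y) =
      e₁ (TensorProduct.rid R A x) (TensorProduct.rid R A y) := by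
  suffices (boxOp e₁ 0 (LinearMap.mul R R)).compr₂ (TensorProduct.rid R A).toLinearMap =
      e₁.compl₁₂ (TensorProduct.rid R A).toLinearMap (TensorProduct.rid R A).toLinearMap
    from LinearMap.congr_fun₂ this x y
  ext
  simp [boxOp_tmul]

end BoxOp

/-! ### The bialgebra `A₊` -/

section Comul

variable {k : Type u} {A : Type v} [Field k] [AddCommGroup A] [Module k A] {o : DNOps k A}

/-- The counit of `A₊`. -/
noncomputable def Aug.counit (h : IsDendNij o) : Aug h →ₐ[k] k := Unitization.fstHom k (StarAlg h)

theorem Aug.counit_incl (h : IsDendNij o) (x : A) : Aug.counit h (Aug.incl h x) = 0 :=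
  Unitization.fst_inr k (StarAlg.of h x)

theorem counit_extOp (h : IsDendNij o) (c : DNOp) (x y : Aug h) :
    Aug.counit h (extOp h c x y) = 0 := Aug.counit_incl h _

theorem unitPart_apply (h : IsDendNij o) (x y : Aug h) :
    unitPart h x y = (Aug.counit h x * Aug.counit h y) • 1 := rfl

theorem tensorOp_eq_boxOp (h : IsDendNij o) (c : DNOp) :
    tensorOp h h c = boxOp (extOp h c) (extOp h c) (unitPart h) := rfl

theorem Aug.linearMap_ext {h : IsDendNij o} {N : Type*} [AddCommMonoid N] [Module k N]
    {f g : Aug h →ₗ[k] N} (h_one : f 1 = g 1) (h_incl : ∀ x, f (incl h x) = g (incl h x)) :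
    f = g := by
  refine LinearMap.ext fun x => ?_
  rw [← fst_smul_one_add_incl_proj h x, map_add, map_add, map_smul, map_smul, h_one, h_incl]

/-- The counit of `A₊ ⊗ A₊`. -/
noncomputable def counitTensor (h : IsDendNij o) : Aug h ⊗[k] Aug h →ₐ[k] k :=
  Algebra.TensorProduct.lift (Aug.counit h) (Aug.counit h) fun _ _ => .all _ _

theorem counitTensor_eq_zero (h : IsDendNij o) {t : Aug h ⊗[k] Aug h} (ht : t ∈ augTensor h h) :
    counitTensor h t = 0 := by
  rw [augTensor_eq_span] at ht
  refine LinearMap.eqOn_span (f := (counitTensor h).toLinearMap) (g := 0) ?_ ht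
  rintro _ (⟨a, rfl⟩ | ⟨a, b, rfl⟩) <;> simp [counitTensor, Aug.counit_incl]

theorem map₂_unitPart_apply (h : IsDendNij o) (x y : Aug h ⊗[k] Aug h) :
    TensorProduct.map₂ (unitPart h) (unitPart h) x y =
      (counitTensor h x * counitTensor h y) • 1 := by
  suffices TensorProduct.map₂ (unitPart h) (unitPart h) =
      ((LinearMap.mul k k).compl₁₂ (counitTensor h).toLinearMap
        (counitTensor h).toLinearMap).compr₂ (LinearMap.toSpanSingleton k _ 1)
    from LinearMap.congr_fun₂ this x y
  apply TensorProduct.ext'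
  intro a b
  apply TensorProduct.ext'
  intro a' b'
  simp [unitPart_apply, counitTensor, Algebra.TensorProduct.one_def, TensorProduct.smul_tmul',
    smul_smul, mul_mul_mul_comm, mul_comm]

theorem tensorOp_one_right (h : IsDendNij o) (c : DNOp) {t : Aug h ⊗[k] Aug h}
    (ht : t ∈ augTensor h h) : tensorOp h h c t 1 = c.rightUnit k • t := by
  rw [augTensor_eq_span] at ht
  refine LinearMap.eqOn_span (f := (tensorOp h h c).flip 1) (g := c.rightUnit k • LinearMap.id)
    ?_ ht
  rintro _ (⟨a, rfl⟩ | ⟨a, b, rfl⟩) <;>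
    simp [Algebra.TensorProduct.one_def, tensorOp_one_one, tensorOp_left, extOp_incl_one,
      TensorProduct.smul_tmul']

theorem tensorOp_one_left (h : IsDendNij o) (c : DNOp) {t : Aug h ⊗[k] Aug h}
    (ht : t ∈ augTensor h h) : tensorOp h h c 1 t = c.leftUnit k • t := by
  rw [augTensor_eq_span] at ht
  refine LinearMap.eqOn_span (f := tensorOp h h c 1) (g := c.leftUnit k • LinearMap.id) ?_ ht
  rintro _ (⟨a, rfl⟩ | ⟨a, b, rfl⟩) <;>
    simp [Algebra.TensorProduct.one_def, tensorOp_one_one, tensorOp_right, extOp_one_incl,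
      TensorProduct.smul_tmul']

theorem tensorOp_one_left_one_right (h : IsDendNij o) (c : DNOp) : tensorOp h h c 1 1 = 0 := by
  rw [Algebra.TensorProduct.one_def, tensorOp_one_one, extOp_one_one, TensorProduct.zero_tmul]

/-- The algebra morphism `A₊ → A₊ ⊗ A₊` induced by a morphism `A → A ⊠ A`. -/
noncomputable def comulOf (h : IsDendNij o) {δ : A →ₗ[k] augTensor h h}
    (hδ : IsDNHom o (augTensorOps h h) δ) : Aug h →ₐ[k] Aug h ⊗[k] Aug h :=
  let δ' : StarAlg h →ₗ[k] Aug h ⊗[k] Aug h :=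
    (augTensor h h).subtype ∘ₗ δ ∘ₗ (StarAlg.of h).symm.toLinearMap
  Unitization.lift
    { δ' with
      map_zero' := map_zero δ'
      map_mul' := fun x y => (congrArg Subtype.val
        (hδ.map_star ((StarAlg.of h).symm x) ((StarAlg.of h).symm y))).trans
          (coe_star_augTensorOps h h _ _) }

variable {h : IsDendNij o} {δ : A →ₗ[k] augTensor h h} (hδ : IsDNHom o (augTensorOps h h) δ)

theorem comulOf_incl (x : A) : comulOf h hδ (Aug.incl h x) = δ x :=
  (Unitization.lift_symm_apply_apply (comulOf h hδ) (StarAlg.of h x)).symm.trans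
    (by rw [comulOf, Equiv.symm_apply_apply]; rfl)

theorem comulOf_incl_mem (x : A) : comulOf h hδ (Aug.incl h x) ∈ augTensor h h :=
  comulOf_incl hδ x ▸ (δ x).2

theorem comulOf_op (c : DNOp) (x y : A) : comulOf h hδ (Aug.incl h (o c x y)) =
    tensorOp h h c (comulOf h hδ (Aug.incl h x)) (comulOf h hδ (Aug.incl h y)) := by
  simp only [comulOf_incl, hδ c x y]
  rfl

theorem comulOf_extOp (c : DNOp) (x y : Aug h) :
    comulOf h hδ (extOp h c x y) = tensorOp h h c (comulOf h hδ x) (comulOf h hδ y) := by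
  suffices (extOp h c).compr₂ (comulOf h hδ).toLinearMap =
      (tensorOp h h c).compl₁₂ (comulOf h hδ).toLinearMap (comulOf h hδ).toLinearMap
    from LinearMap.congr_fun₂ this x y
  refine Aug.linearMap_ext (Aug.linearMap_ext ?_ fun y => ?_) fun x =>
    Aug.linearMap_ext ?_ fun y => ?_
  · simp [extOp_one_one, tensorOp_one_left_one_right]
  · simp [extOp_one_incl, tensorOp_one_left h c (comulOf_incl_mem hδ y)]
  · simp [extOp_incl_one, tensorOp_one_right h c (comulOf_incl_mem hδ x)]
  · simp [extOp_incl_incl, comulOf_op]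

theorem counitTensor_comulOf (x : Aug h) : counitTensor h (comulOf h hδ x) = Aug.counit h x := by
  suffices (counitTensor h).toLinearMap ∘ₗ (comulOf h hδ).toLinearMap = (Aug.counit h).toLinearMap
    from LinearMap.congr_fun this x
  refine Aug.linearMap_ext ?_ fun x => ?_
  · simp
  · simp [counitTensor_eq_zero h (comulOf_incl_mem hδ x), Aug.counit_incl]

theorem comulOf_unitPart (x y : Aug h) : comulOf h hδ (unitPart h x y) =
    TensorProduct.map₂ (unitPart h) (unitPart h) (comulOf h hδ x) (comulOf h hδ y) := by
  rw [map₂_unitPart_apply, counitTensor_comulOf, counitTensor_comulOf, unitPart_apply, map_smul,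
    map_one]

theorem map_comulOf_id_tensorOp (c : DNOp) (x y : Aug h ⊗[k] Aug h) :
    TensorProduct.map (comulOf h hδ).toLinearMap .id (tensorOp h h c x y) =
      boxOp (tensorOp h h c) (extOp h c) (unitPart h)
        (TensorProduct.map (comulOf h hδ).toLinearMap .id x)
        (TensorProduct.map (comulOf h hδ).toLinearMap .id y) :=
  map_boxOp (comulOf_extOp hδ c) (fun _ _ => rfl) (fun _ _ => rfl) x y

theorem map_id_comulOf_tensorOp (c : DNOp) (x y : Aug h ⊗[k] Aug h) :
    TensorProduct.map .id (comulOf h hδ).toLinearMap (tensorOp h h c x y) =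
      boxOp (extOp h c) (tensorOp h h c) (TensorProduct.map₂ (unitPart h) (unitPart h))
        (TensorProduct.map .id (comulOf h hδ).toLinearMap x)
        (TensorProduct.map .id (comulOf h hδ).toLinearMap y) :=
  map_boxOp (f := .id k (Aug h)) (fun _ _ => rfl) (comulOf_extOp hδ c) (comulOf_unitPart hδ) x y

theorem lid_map_counit_id_tensorOp (c : DNOp) (x y : Aug h ⊗[k] Aug h) :
    TensorProduct.lid k _ (TensorProduct.map (Aug.counit h).toLinearMap .id
        (tensorOp h h c x y)) =
      extOp h c (TensorProduct.lid k _ (TensorProduct.map (Aug.counit h).toLinearMap .id x))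
        (TensorProduct.lid k _ (TensorProduct.map (Aug.counit h).toLinearMap .id y)) := by
  rw [← lid_boxOp _ (unitPart h)]
  exact congrArg _ (map_boxOp (e₁' := 0) (g := .id) (counit_extOp h c) (fun _ _ => rfl)
    (fun _ _ => rfl) x y)

theorem rid_map_id_counit_tensorOp (c : DNOp) (x y : Aug h ⊗[k] Aug h) :
    TensorProduct.rid k _ (TensorProduct.map .id (Aug.counit h).toLinearMap
        (tensorOp h h c x y)) =
      extOp h c (TensorProduct.rid k _ (TensorProduct.map .id (Aug.counit h).toLinearMap x))
        (TensorProduct.rid k _ (TensorProduct.map .id (Aug.counit h).toLinearMap y)) := by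
  have counit_unitPart (x y : Aug h) : Aug.counit h (unitPart h x y) =
      LinearMap.mul k k (Aug.counit h x) (Aug.counit h y) := by simp [unitPart_apply]
  rw [← rid_boxOp]
  exact congrArg _ (map_boxOp (f := .id k (Aug h)) (fun _ _ => rfl) (counit_extOp h c)
    counit_unitPart x y)

/-- `A` is generated by the image of `i : V → A`. -/
def DNGenerates {V : Type w} [AddCommGroup V] [Module k V] (o : DNOps k A) (i : V →ₗ[k] A) :
    Prop :=
  ∀ p : Submodule k A, (∀ v, i v ∈ p) → (∀ c, ∀ x ∈ p, ∀ y ∈ p, o c x y ∈ p) → p = ⊤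

variable {V : Type w} [AddCommGroup V] [Module k V] {i : V →ₗ[k] A}

theorem DNGenerates.algHom_ext (hi : DNGenerates o i) {R : Type*} [Semiring R] [Algebra k R]
    {f g : Aug h →ₐ[k] R} (h_gen : ∀ v, f (Aug.incl h (i v)) = g (Aug.incl h (i v)))
    (h_op : ∀ c x y, f (Aug.incl h x) = g (Aug.incl h x) → f (Aug.incl h y) = g (Aug.incl h y) →
      f (Aug.incl h (o c x y)) = g (Aug.incl h (o c x y))) : f = g := by
  have eqLocus_eq_top := hi
    (LinearMap.eqLocus (f.toLinearMap ∘ₗ Aug.incl h) (g.toLinearMap ∘ₗ Aug.incl h)) h_gen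
    fun c x hx y hy => h_op c x y hx hy
  have eqOn_incl (x : A) : f (Aug.incl h x) = g (Aug.incl h x) :=
    (eqLocus_eq_top.ge trivial : x ∈ LinearMap.eqLocus _ _)
  exact AlgHom.toLinearMap_injective
    (Aug.linearMap_ext ((map_one f).trans (map_one g).symm) eqOn_incl)

variable (hi : DNGenerates o i)
  (hv : ∀ v, (δ (i v) : Aug h ⊗[k] Aug h) = 1 ⊗ₜ Aug.incl h (i v) + Aug.incl h (i v) ⊗ₜ 1)

include hi hv

theorem comulOf_coassoc :
    (Algebra.TensorProduct.assoc k k k (Aug h) (Aug h) (Aug h)).toAlgHom.comp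
        ((Algebra.TensorProduct.map (comulOf h hδ) (.id k (Aug h))).comp (comulOf h hδ)) =
      (Algebra.TensorProduct.map (.id k (Aug h)) (comulOf h hδ)).comp (comulOf h hδ) := by
  refine hi.algHom_ext (fun v => ?_) fun c x y hx hy => ?_
  · simp [comulOf_incl, hv, TensorProduct.tmul_add, TensorProduct.add_tmul,
      Algebra.TensorProduct.one_def, add_assoc]
  · rw [AlgHom.comp_apply, AlgHom.comp_apply, AlgHom.comp_apply] at hx hy ⊢
    change TensorProduct.assoc k _ _ _ (TensorProduct.map (comulOf h hδ).toLinearMap .id _) =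
      TensorProduct.map .id (comulOf h hδ).toLinearMap _ at hx hy ⊢
    rw [comulOf_op, map_comulOf_id_tensorOp, map_id_comulOf_tensorOp, tensorOp_eq_boxOp,
      assoc_boxOp, hx, hy]

theorem comulOf_rTensor_counit :
    (Algebra.TensorProduct.map (Aug.counit h) (.id k (Aug h))).comp (comulOf h hδ) =
      (Algebra.TensorProduct.lid k (Aug h)).symm := by
  refine hi.algHom_ext (fun v => ?_) fun c x y hx hy => ?_
  · simp [comulOf_incl, hv, Aug.counit_incl]
  · rw [AlgHom.comp_apply] at hx hy ⊢
    change TensorProduct.map (Aug.counit h).toLinearMap .id _ = (TensorProduct.lid k _).symm _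
      at hx hy ⊢
    rw [LinearEquiv.eq_symm_apply] at hx hy ⊢
    rw [comulOf_op, lid_map_counit_id_tensorOp, hx, hy, extOp_incl_incl]

theorem comulOf_lTensor_counit :
    (Algebra.TensorProduct.map (.id k (Aug h)) (Aug.counit h)).comp (comulOf h hδ) =
      (Algebra.TensorProduct.rid k k (Aug h)).symm := by
  refine hi.algHom_ext (fun v => ?_) fun c x y hx hy => ?_
  · simp [comulOf_incl, hv, Aug.counit_incl]
  · rw [AlgHom.comp_apply] at hx hy ⊢
    change TensorProduct.map .id (Aug.counit h).toLinearMap _ = (TensorProduct.rid k _).symm _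
      at hx hy ⊢
    rw [LinearEquiv.eq_symm_apply] at hx hy ⊢
    rw [comulOf_op, rid_map_id_counit_tensorOp, hx, hy, extOp_incl_incl]

end Comul

/-! ### The filtration of a connected bialgebra -/

section Connected

variable {k : Type u} {H : Type v} [Field k] [Ring H] [Algebra k H]

/-- The subspace `P ⊗ P` of `H ⊗ H`. -/
def tensorSquare (P : Submodule k H) : Submodule k (H ⊗[k] H) :=
  Submodule.map₂ (TensorProduct.mk k H H) P P

theorem tmul_mem_tensorSquare {P : Submodule k H} {x y : H} (hx : x ∈ P) (hy : y ∈ P) :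
    x ⊗ₜ y ∈ tensorSquare P :=
  Submodule.apply_mem_map₂ _ hx hy

theorem tensorSquare_mono : Monotone (tensorSquare : Submodule k H → Submodule k (H ⊗[k] H)) :=
  fun _ _ h => Submodule.map₂_le_map₂ h h

theorem map₂_boxOp_tensorSquare_le {e u : H →ₗ[k] H →ₗ[k] H} {P Q N : Submodule k H}
    (h_mul : Submodule.map₂ (LinearMap.mul k H) P Q ≤ N) (he : Submodule.map₂ e P Q ≤ N)
    (hu : Submodule.map₂ u P Q ≤ N) :
    Submodule.map₂ (boxOp e e u) (tensorSquare P) (tensorSquare Q) ≤ tensorSquare N := by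
  rw [Submodule.map₂_le] at h_mul he hu ⊢
  have apply_tmul_mem {a b : H} (ha : a ∈ P) (hb : b ∈ P) :
      tensorSquare Q ≤ (tensorSquare N).comap (boxOp e e u (a ⊗ₜ b)) :=
    Submodule.map₂_le.2 fun a' ha' b' hb' =>
      add_mem (tmul_mem_tensorSquare (h_mul a ha a' ha') (he b hb b' hb'))
        (tmul_mem_tensorSquare (he a ha a' ha') (hu b hb b' hb'))
  intro x hx y hy
  have flip_apply_mem : tensorSquare P ≤ (tensorSquare N).comap ((boxOp e e u).flip y) :=
    Submodule.map₂_le.2 fun a ha b hb => apply_tmul_mem ha hb hy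
  exact flip_apply_mem hx

variable (Δ : H →ₐ[k] H ⊗[k] H)

theorem mem_connFiltration_succ {r : ℕ} {x : H} :
    x ∈ connFiltration Δ (r + 1) ↔ reducedComul Δ x ∈ tensorSquare (connFiltration Δ r) := by
  rw [connFiltration, Submodule.mem_comap, TensorProduct.range_map, Submodule.range_subtype,
    tensorSquare]

theorem reducedComul_apply (x : H) : reducedComul Δ x = Δ x - 1 ⊗ₜ x - x ⊗ₜ 1 := rfl

theorem comul_eq_reducedComul_add (x : H) :
    Δ x = reducedComul Δ x + (1 ⊗ₜ x + x ⊗ₜ 1) := by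
  rw [reducedComul_apply]
  abel

theorem connFiltration_mono : Monotone (connFiltration Δ) := by
  refine monotone_nat_of_le_succ fun r => ?_
  induction r with
  | zero =>
    refine Submodule.span_le.2 (Set.singleton_subset_iff.2 ?_)
    have one_mem : (1 : H) ∈ connFiltration Δ 0 := Submodule.mem_span_singleton_self 1
    rw [SetLike.mem_coe, mem_connFiltration_succ, reducedComul_apply, map_one,
      Algebra.TensorProduct.one_def, sub_self, zero_sub]
    exact neg_mem (tmul_mem_tensorSquare one_mem one_mem)
  | succ r ih =>
    intro x hx
    rw [mem_connFiltration_succ] at hx ⊢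
    exact tensorSquare_mono ih hx

theorem one_mem_connFiltration (r : ℕ) : (1 : H) ∈ connFiltration Δ r :=
  connFiltration_mono Δ (Nat.zero_le r) (Submodule.mem_span_singleton_self 1)

variable {Δ}

theorem one_tmul_add_tmul_one_mem {r : ℕ} {x : H} (hx : x ∈ connFiltration Δ r) :
    1 ⊗ₜ x + x ⊗ₜ 1 ∈ tensorSquare (connFiltration Δ r) :=
  add_mem (tmul_mem_tensorSquare (one_mem_connFiltration Δ r) hx)
    (tmul_mem_tensorSquare hx (one_mem_connFiltration Δ r))

theorem comul_mem_tensorSquare {r : ℕ} {x : H} (hx : x ∈ connFiltration Δ r) :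
    Δ x ∈ tensorSquare (connFiltration Δ r) := by
  rw [comul_eq_reducedComul_add]
  exact add_mem ((mem_connFiltration_succ Δ).1 (connFiltration_mono Δ r.le_succ hx))
    (one_tmul_add_tmul_one_mem hx)

variable (Δ) in
/-- The operation `e` on `H` is compatible with `Δ`, when `H ⊗ H` carries the corresponding
operation `boxOp e e u`; the product and the nine operations of `A₊` are of this kind. -/
structure IsBoxCompatible (e u : H →ₗ[k] H →ₗ[k] H) : Prop where
  comul_apply : ∀ x y, Δ (e x y) = boxOp e e u (Δ x) (Δ y)
  one_tmul : ∀ x y, boxOp e e u (1 ⊗ₜ x) (1 ⊗ₜ y) = 1 ⊗ₜ e x y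
  tmul_one : ∀ x y, boxOp e e u (x ⊗ₜ 1) (y ⊗ₜ 1) = e x y ⊗ₜ 1
  scalar_mem : ∀ x y, u x y ∈ connFiltration Δ 0
  one_apply_mem : ∀ {r x}, x ∈ connFiltration Δ r → e 1 x ∈ connFiltration Δ r
  apply_one_mem : ∀ {r x}, x ∈ connFiltration Δ r → e x 1 ∈ connFiltration Δ r

namespace IsBoxCompatible

variable {e u : H →ₗ[k] H →ₗ[k] H} (h : IsBoxCompatible Δ e u)

include h

theorem reducedComul_apply (x y : H) :
    reducedComul Δ (e x y) =
      boxOp e e u (reducedComul Δ x) (Δ y) + boxOp e e u (1 ⊗ₜ x + x ⊗ₜ 1) (reducedComul Δ y) +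
        (boxOp e e u (1 ⊗ₜ x) (y ⊗ₜ 1) + boxOp e e u (x ⊗ₜ 1) (1 ⊗ₜ y)) := by
  have boxOp_comul : boxOp e e u (Δ x) (Δ y) =
      boxOp e e u (reducedComul Δ x) (Δ y) + (boxOp e e u (1 ⊗ₜ x + x ⊗ₜ 1) (reducedComul Δ y) +
        boxOp e e u (1 ⊗ₜ x + x ⊗ₜ 1) (1 ⊗ₜ y + y ⊗ₜ 1)) := by
    rw [← map_add (boxOp e e u _), ← comul_eq_reducedComul_add, ← LinearMap.add_apply, ← map_add,
      ← comul_eq_reducedComul_add]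
  rw [_root_.reducedComul_apply, h.comul_apply, boxOp_comul, ← h.one_tmul, ← h.tmul_one]
  simp only [map_add, LinearMap.add_apply]
  abel

theorem map₂_scalar_le (P Q : Submodule k H) (r : ℕ) :
    Submodule.map₂ u P Q ≤ connFiltration Δ r :=
  Submodule.map₂_le.2 fun x _ y _ => connFiltration_mono Δ r.zero_le (h.scalar_mem x y)

theorem boxOp_one_tmul_tmul_one_mem {r : ℕ} {x y : H} (hx : x ∈ connFiltration Δ r)
    (hy : y ∈ connFiltration Δ r) :
    boxOp e e u (1 ⊗ₜ x) (y ⊗ₜ 1) ∈ tensorSquare (connFiltration Δ r) := by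
  rw [boxOp_tmul, one_mul]
  exact add_mem (tmul_mem_tensorSquare hy (h.apply_one_mem hx))
    (tmul_mem_tensorSquare (h.one_apply_mem hy)
      (connFiltration_mono Δ r.zero_le (h.scalar_mem x 1)))

theorem boxOp_tmul_one_one_tmul_mem {r : ℕ} {x y : H} (hx : x ∈ connFiltration Δ r)
    (hy : y ∈ connFiltration Δ r) :
    boxOp e e u (x ⊗ₜ 1) (1 ⊗ₜ y) ∈ tensorSquare (connFiltration Δ r) := by
  rw [boxOp_tmul, mul_one]
  exact add_mem (tmul_mem_tensorSquare hx (h.one_apply_mem hy))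
    (tmul_mem_tensorSquare (h.apply_one_mem hx)
      (connFiltration_mono Δ r.zero_le (h.scalar_mem 1 y)))

theorem map₂_succ_succ_le {r s : ℕ}
    (h_mul : ∀ r' s', r' + s' < r + 1 + (s + 1) → Submodule.map₂ (LinearMap.mul k H)
      (connFiltration Δ r') (connFiltration Δ s') ≤ connFiltration Δ (r' + s'))
    (h_op : ∀ r' s', r' + s' < r + 1 + (s + 1) →
      Submodule.map₂ e (connFiltration Δ r') (connFiltration Δ s') ≤ connFiltration Δ (r' + s')) :
    Submodule.map₂ e (connFiltration Δ (r + 1)) (connFiltration Δ (s + 1)) ≤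
      connFiltration Δ (r + 1 + (s + 1)) := by
  have boxOp_mem {r' s' : ℕ} (hn : r' + s' = r + s + 1) {t t' : H ⊗[k] H}
      (ht : t ∈ tensorSquare (connFiltration Δ r'))
      (ht' : t' ∈ tensorSquare (connFiltration Δ s')) :
      boxOp e e u t t' ∈ tensorSquare (connFiltration Δ (r + s + 1)) :=
    map₂_boxOp_tensorSquare_le (hn ▸ h_mul r' s' (by lia)) (hn ▸ h_op r' s' (by lia))
      (h.map₂_scalar_le _ _ _) (Submodule.apply_mem_map₂ _ ht ht')
  refine Submodule.map₂_le.2 fun x hx y hy => ?_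
  have hx' := connFiltration_mono Δ (by lia : r + 1 ≤ r + s + 1) hx
  have hy' := connFiltration_mono Δ (by lia : s + 1 ≤ r + s + 1) hy
  rw [show r + 1 + (s + 1) = r + s + 1 + 1 by lia, mem_connFiltration_succ, h.reducedComul_apply]
  exact add_mem
    (add_mem
      (boxOp_mem (by lia) ((mem_connFiltration_succ Δ).1 hx) (comul_mem_tensorSquare hy))
      (boxOp_mem (by lia) (one_tmul_add_tmul_one_mem hx) ((mem_connFiltration_succ Δ).1 hy)))
    (add_mem (h.boxOp_one_tmul_tmul_one_mem hx' hy') (h.boxOp_tmul_one_one_tmul_mem hx' hy'))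

theorem map₂_zero_left_le (s : ℕ) :
    Submodule.map₂ e (connFiltration Δ 0) (connFiltration Δ s) ≤ connFiltration Δ s := by
  refine Submodule.map₂_le.2 fun x hx y hy => ?_
  obtain ⟨a, rfl⟩ := Submodule.mem_span_singleton.1 hx
  rw [map_smul, LinearMap.smul_apply]
  exact Submodule.smul_mem _ a (h.one_apply_mem hy)

theorem map₂_zero_right_le (r : ℕ) :
    Submodule.map₂ e (connFiltration Δ r) (connFiltration Δ 0) ≤ connFiltration Δ r := by
  refine Submodule.map₂_le.2 fun x hx y hy => ?_
  obtain ⟨a, rfl⟩ := Submodule.mem_span_singleton.1 hy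
  rw [map_smul]
  exact Submodule.smul_mem _ a (h.apply_one_mem hx)

theorem map₂_le_of_step
    (h_step : ∀ r s, (∀ r' s', r' + s' < r + 1 + (s + 1) → Submodule.map₂ e
        (connFiltration Δ r') (connFiltration Δ s') ≤ connFiltration Δ (r' + s')) →
      Submodule.map₂ e (connFiltration Δ (r + 1)) (connFiltration Δ (s + 1)) ≤
        connFiltration Δ (r + 1 + (s + 1))) (r s : ℕ) :
    Submodule.map₂ e (connFiltration Δ r) (connFiltration Δ s) ≤ connFiltration Δ (r + s) := by
  induction hn : r + s using Nat.strong_induction_on generalizing r s with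
  | _ n ih =>
    subst hn
    match r, s with
    | 0, s => exact (zero_add s).symm ▸ h.map₂_zero_left_le s
    | r + 1, 0 => exact h.map₂_zero_right_le (r + 1)
    | r + 1, s + 1 => exact h_step r s fun r' s' hlt => ih _ hlt r' s' rfl

end IsBoxCompatible

variable (Δ)

theorem isBoxCompatible_mul : IsBoxCompatible Δ (LinearMap.mul k H) 0 where
  comul_apply x y := by
    have mul_eq_boxOp : LinearMap.mul k (H ⊗[k] H) =
        boxOp (LinearMap.mul k H) (LinearMap.mul k H) 0 := by
      ext
      simp [boxOp_tmul]
    rw [LinearMap.mul_apply', map_mul, ← mul_eq_boxOp, LinearMap.mul_apply']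
  one_tmul := by simp [boxOp_tmul]
  tmul_one := by simp [boxOp_tmul]
  scalar_mem _ _ := zero_mem _
  one_apply_mem := by simp
  apply_one_mem := by simp

theorem map₂_mul_connFiltration_le (r s : ℕ) :
    Submodule.map₂ (LinearMap.mul k H) (connFiltration Δ r) (connFiltration Δ s) ≤
      connFiltration Δ (r + s) :=
  (isBoxCompatible_mul Δ).map₂_le_of_step
    (fun _ _ ih => (isBoxCompatible_mul Δ).map₂_succ_succ_le ih ih) r s

variable {Δ}

theorem IsBoxCompatible.map₂_connFiltration_le {e u : H →ₗ[k] H →ₗ[k] H}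
    (h : IsBoxCompatible Δ e u) (r s : ℕ) :
    Submodule.map₂ e (connFiltration Δ r) (connFiltration Δ s) ≤ connFiltration Δ (r + s) :=
  h.map₂_le_of_step
    (fun _ _ ih => h.map₂_succ_succ_le (fun r' s' _ => map₂_mul_connFiltration_le Δ r' s') ih) r s

end Connected

/-! ### Convolution inverses -/

section Convolution

open WithConv

theorem exists_linearMap_eq_sum_range {R M N : Type*} [Semiring R] [AddCommMonoid M] [Module R M]
    [AddCommMonoid N] [Module R N] {F : ℕ → Submodule R M} (hF : ∀ x, ∃ r, x ∈ F r)
    {f : ℕ → M →ₗ[R] N} (hf : ∀ r n, r < n → ∀ x ∈ F r, f n x = 0) :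
    ∃ S : M →ₗ[R] N, ∀ r, ∀ x ∈ F r, S x = ∑ n ∈ Finset.range (r + 1), f n x := by
  have support_subset {r : ℕ} {x : M} (hx : x ∈ F r) :
      (Function.support fun n => f n x) ⊆ Finset.range (r + 1) := fun n hn => by
    by_contra hnr
    exact hn (hf r n (by simpa using hnr) x hx)
  have finite_support (x : M) : (Function.support fun n => f n x).Finite :=
    (Finset.finite_toSet _).subset (support_subset (hF x).choose_spec)
  refine ⟨{ toFun := fun x => ∑ᶠ n, f n x, map_add' := fun x y => ?_, map_smul' := fun a x => ?_ },
    fun r x hx => finsum_eq_sum_of_support_subset _ (support_subset hx)⟩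
  · simp only [map_add]
    exact finsum_add_distrib (finite_support x) (finite_support y)
  · simp only [map_smul]
    exact (smul_finsum' a (finite_support x)).symm

variable {k : Type u} {H : Type v} {A : Type w} [Field k] [Ring H] [Bialgebra k H] [Ring A]
  [Algebra k A]

theorem convMul_congr {f f' g g' : WithConv (H →ₗ[k] A)} {r : ℕ} {x : H}
    (hf : ∀ a ∈ connFiltration (Bialgebra.comulAlgHom k H) r, f a = f' a)
    (hg : ∀ a ∈ connFiltration (Bialgebra.comulAlgHom k H) r, g a = g' a)
    (hx : x ∈ connFiltration (Bialgebra.comulAlgHom k H) r) : (f * g) x = (f' * g') x := by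
  have tensorSquare_le : tensorSquare (connFiltration (Bialgebra.comulAlgHom k H) r) ≤
      LinearMap.eqLocus (TensorProduct.map f.ofConv g.ofConv)
        (TensorProduct.map f'.ofConv g'.ofConv) :=
    Submodule.map₂_le.2 fun a ha b hb => congrArg₂ (· ⊗ₜ ·) (hf a ha) (hg b hb)
  exact congrArg (LinearMap.mul' k A) (tensorSquare_le (comul_mem_tensorSquare hx))

theorem convMul_apply_one (f g : WithConv (H →ₗ[k] A)) : (f * g) 1 = f 1 * g 1 := by
  rw [LinearMap.convMul_apply, Bialgebra.comul_one, Algebra.TensorProduct.one_def,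
    TensorProduct.map_tmul, LinearMap.mul'_apply]

theorem convPow_apply_one {g : WithConv (H →ₗ[k] A)} (hg : g 1 = 0) {n : ℕ} (hn : n ≠ 0) :
    (g ^ n) 1 = 0 := by
  obtain ⟨n, rfl⟩ := Nat.exists_eq_succ_of_ne_zero hn
  rw [pow_succ', convMul_apply_one, hg, zero_mul]

theorem convPow_apply_eq_zero {g : WithConv (H →ₗ[k] A)} (hg : g 1 = 0) {n r : ℕ} (hn : r < n) :
    ∀ x ∈ connFiltration (Bialgebra.comulAlgHom k H) r, (g ^ n) x = 0 := by
  induction n generalizing r with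
  | zero => omega
  | succ n ih =>
    intro x hx
    obtain _ | r := r
    · obtain ⟨a, rfl⟩ := Submodule.mem_span_singleton.1 hx
      exact (map_smul (g ^ (n + 1)).ofConv a 1).trans
        ((congrArg _ (convPow_apply_one hg n.succ_ne_zero)).trans (smul_zero a))
    have convPow_one : (g ^ n).ofConv 1 = 0 := convPow_apply_one hg (by lia)
    have tensorSquare_le : tensorSquare (connFiltration (Bialgebra.comulAlgHom k H) r) ≤
        LinearMap.ker (TensorProduct.map g.ofConv (g ^ n).ofConv) :=
      Submodule.map₂_le.2 fun a _ b hb =>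
        (congrArg (g a ⊗ₜ[k] ·) (ih (by lia) b hb)).trans (TensorProduct.tmul_zero _ _)
    have map_reducedComul :=
      LinearMap.mem_ker.1 (tensorSquare_le ((mem_connFiltration_succ _).1 hx))
    rw [pow_succ', LinearMap.convMul_apply, ← Bialgebra.comulAlgHom_apply,
      comul_eq_reducedComul_add, map_add (TensorProduct.map _ _), map_reducedComul,
      map_add (TensorProduct.map _ _), TensorProduct.map_tmul, TensorProduct.map_tmul, hg,
      convPow_one, TensorProduct.zero_tmul, TensorProduct.tmul_zero, add_zero, add_zero, map_zero]

theorem isUnit_of_apply_one_eq_one (hH : IsConnectedComul (Bialgebra.comulAlgHom k H))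
    {f : WithConv (H →ₗ[k] A)} (hf : f 1 = 1) : IsUnit f := by
  obtain ⟨g, rfl⟩ : ∃ g, f = 1 - g := ⟨1 - f, (sub_sub_cancel 1 f).symm⟩
  have hg : g 1 = 0 := by simpa using hf
  -- The inverse of `1 - g` is the geometric series `∑ gⁿ`, which is finite on each `Fᵣ`.
  obtain ⟨S, hS⟩ := exists_linearMap_eq_sum_range hH.2 (f := fun n => (g ^ n).ofConv)
    fun r n hn => convPow_apply_eq_zero hg hn
  have toConv_S_apply {r : ℕ} {x : H} (hx : x ∈ connFiltration (Bialgebra.comulAlgHom k H) r) :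
      toConv S x = (∑ n ∈ Finset.range (r + 1), g ^ n) x := by
    rw [hS r x hx, ← LinearMap.sum_apply]
    exact LinearMap.congr_fun (map_sum (WithConv.addEquiv _) _ _).symm x
  have one_sub_pow_apply {r : ℕ} {x : H} (hx : x ∈ connFiltration (Bialgebra.comulAlgHom k H) r) :
      (1 - g ^ (r + 1)) x = (1 : WithConv (H →ₗ[k] A)) x :=
    (congrArg _ (convPow_apply_eq_zero hg r.lt_succ_self x hx)).trans (sub_zero _)
  refine isUnit_iff_exists.2 ⟨toConv S, ?_, ?_⟩
  · ext x
    obtain ⟨r, hx⟩ := hH.2 x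
    refine (convMul_congr (fun _ _ => rfl) (fun a => toConv_S_apply) hx).trans ?_
    rw [mul_neg_geom_sum, one_sub_pow_apply hx]
  · ext x
    obtain ⟨r, hx⟩ := hH.2 x
    refine (convMul_congr (fun a => toConv_S_apply) (fun _ _ => rfl) hx).trans ?_
    rw [geom_sum_mul_neg, one_sub_pow_apply hx]

end Convolution

theorem isHopf_of_isConnectedComul {k : Type u} {H : Type v} [Field k] [Ring H] [Algebra k H]
    {Δ : H →ₐ[k] H ⊗[k] H} {ε : H →ₐ[k] k}
    (h_coassoc : (Algebra.TensorProduct.assoc k k k H H H).toAlgHom.comp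
        ((Algebra.TensorProduct.map Δ (.id k H)).comp Δ) =
      (Algebra.TensorProduct.map (.id k H) Δ).comp Δ)
    (h_rTensor : (Algebra.TensorProduct.map ε (.id k H)).comp Δ =
      (Algebra.TensorProduct.lid k H).symm)
    (h_lTensor : (Algebra.TensorProduct.map (.id k H) ε).comp Δ =
      (Algebra.TensorProduct.rid k k H).symm)
    (hΔ : IsConnectedComul Δ) : IsHopf Δ ε := by
  refine ⟨h_coassoc, h_rTensor, h_lTensor, ?_⟩
  let B : Bialgebra k H := Bialgebra.ofAlgHom Δ ε h_coassoc h_rTensor h_lTensor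
  have isUnit_id : IsUnit (WithConv.toConv LinearMap.id : WithConv (H →ₗ[k] H)) :=
    isUnit_of_apply_one_eq_one hΔ rfl
  obtain ⟨S, id_mul, mul_id⟩ := isUnit_iff_exists.1 isUnit_id
  exact ⟨{ B with
    antipode := S.ofConv
    mul_antipode_rTensor_comul := congrArg WithConv.ofConv mul_id
    mul_antipode_lTensor_comul := congrArg WithConv.ofConv id_mul }, rfl⟩

/-! ### The augmented free algebras -/

section Free

variable {k : Type u} {A : Type v} [Field k] [AddCommGroup A] [Module k A] {o : DNOps k A}

theorem extOp_one_left (h : IsDendNij o) (c : DNOp) (x : Aug h) :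
    extOp h c 1 x = c.leftUnit k • Aug.incl h (Aug.proj h x) := by
  nth_rw 1 [← Aug.fst_smul_one_add_incl_proj h x]
  rw [map_add, map_smul, extOp_one_one, smul_zero, zero_add, extOp_one_incl]

theorem extOp_one_right (h : IsDendNij o) (c : DNOp) (x : Aug h) :
    extOp h c x 1 = c.rightUnit k • Aug.incl h (Aug.proj h x) := by
  nth_rw 1 [← Aug.fst_smul_one_add_incl_proj h x]
  rw [map_add, map_smul, LinearMap.add_apply, LinearMap.smul_apply, extOp_one_one, smul_zero,
    zero_add, extOp_incl_one]

variable {h : IsDendNij o}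

theorem incl_proj_mem_connFiltration {Δ : Aug h →ₐ[k] Aug h ⊗[k] Aug h} {r : ℕ} {x : Aug h}
    (hx : x ∈ connFiltration Δ r) : Aug.incl h (Aug.proj h x) ∈ connFiltration Δ r := by
  rw [eq_sub_of_add_eq' (Aug.fst_smul_one_add_incl_proj h x)]
  exact sub_mem hx (Submodule.smul_mem _ _ (one_mem_connFiltration Δ r))

variable {δ : A →ₗ[k] augTensor h h} (hδ : IsDNHom o (augTensorOps h h) δ)

theorem isBoxCompatible_extOp (c : DNOp) :
    IsBoxCompatible (comulOf h hδ) (extOp h c) (unitPart h) where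
  comul_apply := comulOf_extOp hδ c
  one_tmul x y := by rw [boxOp_tmul, extOp_one_one, TensorProduct.zero_tmul, add_zero, one_mul]
  tmul_one := tensorOp_one_one h h c
  scalar_mem _ _ := Submodule.smul_mem _ _ (one_mem_connFiltration _ 0)
  one_apply_mem hx := by
    rw [extOp_one_left]
    exact Submodule.smul_mem _ _ (incl_proj_mem_connFiltration hx)
  apply_one_mem hx := by
    rw [extOp_one_right]
    exact Submodule.smul_mem _ _ (incl_proj_mem_connFiltration hx)

variable {V : Type w} [AddCommGroup V] [Module k V] {i : V →ₗ[k] A}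

theorem isConnectedComul_comulOf (hi : DNGenerates o i)
    (hv : ∀ v, (δ (i v) : Aug h ⊗[k] Aug h) = 1 ⊗ₜ Aug.incl h (i v) + Aug.incl h (i v) ⊗ₜ 1) :
    IsConnectedComul (comulOf h hδ) := by
  have mono := connFiltration_mono (comulOf h hδ)
  have mem_iSup {x : Aug h} : x ∈ ⨆ r, connFiltration (comulOf h hδ) r ↔
      ∃ r, x ∈ connFiltration (comulOf h hδ) r := Submodule.mem_iSup_of_directed _ mono.directed_le
  have gen_mem (v : V) : Aug.incl h (i v) ∈ connFiltration (comulOf h hδ) 1 := by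
    rw [mem_connFiltration_succ, reducedComul_apply, comulOf_incl, hv, add_sub_cancel_left,
      sub_self]
    exact zero_mem _
  have op_mem (c : DNOp) (x y : A) {r s : ℕ} (hx : Aug.incl h x ∈ connFiltration (comulOf h hδ) r)
      (hy : Aug.incl h y ∈ connFiltration (comulOf h hδ) s) :
      Aug.incl h (o c x y) ∈ connFiltration (comulOf h hδ) (r + s) :=
    extOp_incl_incl h c x y ▸
      (isBoxCompatible_extOp hδ c).map₂_connFiltration_le r s (Submodule.apply_mem_map₂ _ hx hy)
  have comap_iSup_eq_top := hi ((⨆ r, connFiltration (comulOf h hδ) r).comap (Aug.incl h))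
    (fun v => mem_iSup.2 ⟨1, gen_mem v⟩) fun c x hx y hy => by
      obtain ⟨r, hr⟩ := mem_iSup.1 hx
      obtain ⟨s, hs⟩ := mem_iSup.1 hy
      exact mem_iSup.2 ⟨r + s, op_mem c x y hr hs⟩
  refine ⟨mono, fun x => ?_⟩
  obtain ⟨r, hr⟩ := mem_iSup.1
    (comap_iSup_eq_top.ge trivial : Aug.proj h x ∈ Submodule.comap (Aug.incl h) _)
  exact ⟨r, Aug.fst_smul_one_add_incl_proj h x ▸
    add_mem (Submodule.smul_mem _ _ (one_mem_connFiltration _ r)) hr⟩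

theorem DNGenerates.hasConnectedHopf (hi : DNGenerates o i)
    (h_lift : ∀ f : V →ₗ[k] augTensor h h,
      ∃ g : A →ₗ[k] augTensor h h, IsDNHom o (augTensorOps h h) g ∧ g ∘ₗ i = f) :
    HasConnectedHopf h i := by
  let primitive : V →ₗ[k] Aug h ⊗[k] Aug h :=
    TensorProduct.mk k (Aug h) (Aug h) 1 ∘ₗ Aug.incl h ∘ₗ i +
      (TensorProduct.mk k (Aug h) (Aug h)).flip 1 ∘ₗ Aug.incl h ∘ₗ i
  obtain ⟨δ, hδ, hδi⟩ := h_lift (primitive.codRestrict (augTensor h h) fun v =>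
    add_mem (tmul_incl_mem_augTensor h h _ _) (incl_tmul_one_mem_augTensor h h _))
  have δ_gen (v : V) :
      (δ (i v) : Aug h ⊗[k] Aug h) = 1 ⊗ₜ Aug.incl h (i v) + Aug.incl h (i v) ⊗ₜ 1 :=
    congrArg Subtype.val (LinearMap.congr_fun hδi v)
  have connected := isConnectedComul_comulOf hδ hi δ_gen
  have hopf := isHopf_of_isConnectedComul (comulOf_coassoc hδ hi δ_gen)
    (comulOf_rTensor_counit hδ hi δ_gen) (comulOf_lTensor_counit hδ hi δ_gen) connected
  exact ⟨comulOf h hδ, Aug.counit h, hopf, connected, fun _ => rfl,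
    fun v => (comulOf_incl hδ _).trans (δ_gen v), comulOf_incl_mem hδ, comulOf_op hδ⟩

theorem IsDendNij.restrict {p : Submodule k A} (h : IsDendNij o)
    (hp : ∀ c, ∀ x ∈ p, ∀ y ∈ p, o c x y ∈ p) : IsDendNij (DNOps.restrict o p hp) :=
  DNOps.isDendNij_restrict fun r hr x _ y _ z _ => isDendNij_iff.1 h r hr x y z

theorem dnGenerates_of_lift
    (h_lift : ∀ (p : Submodule k A) (hp : ∀ c, ∀ x ∈ p, ∀ y ∈ p, o c x y ∈ p) (f : V →ₗ[k] p),
      ∃ g : A →ₗ[k] p, IsDNHom o (DNOps.restrict o p hp) g ∧ g ∘ₗ i = f)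
    (h_unique : ∀ g : A →ₗ[k] A, IsDNHom o o g → g ∘ₗ i = i → g = LinearMap.id) :
    DNGenerates o i := by
  intro p hv hp
  obtain ⟨g, hg, hgi⟩ := h_lift p hp (i.codRestrict p hv)
  have subtype_comp_eq_id : p.subtype ∘ₗ g = LinearMap.id :=
    h_unique _ (fun c x y => congrArg p.subtype (hg c x y)) (by rw [LinearMap.comp_assoc, hgi]; rfl)
  refine eq_top_iff.2 fun x _ => ?_
  rw [← LinearMap.id_apply (R := k) x, ← subtype_comp_eq_id]
  exact (g x).2

end Free

section Universal

variable {k : Type u} {V : Type v} {F : Type (max u v)} [Field k] [AddCommGroup V] [Module k V]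
  [AddCommGroup F] [Module k F] {o : DNOps k F} {i : V →ₗ[k] F}

theorem IsFreeDN.dnGenerates (hF : IsFreeDN o i) : DNGenerates o i :=
  dnGenerates_of_lift
    (fun p _ f => (hF.existsUnique_lift p _ (hF.isDendNij.restrict _) f).exists)
    fun _ hg hgi => (hF.existsUnique_lift F o hF.isDendNij i).unique ⟨hg, hgi⟩
      ⟨fun _ _ _ => rfl, rfl⟩

theorem IsFreeCommDN.dnGenerates (hF : IsFreeCommDN o i) : DNGenerates o i :=
  dnGenerates_of_lift
    (fun p _ f => (hF.existsUnique_lift p _ (hF.isDendNij.restrict _)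
      (DNOps.isCommDN_restrict fun c x _ y _ => hF.isComm c x y) f).exists)
    fun _ hg hgi => (hF.existsUnique_lift F o hF.isDendNij hF.isComm i).unique ⟨hg, hgi⟩
      ⟨fun _ _ _ => rfl, rfl⟩

end Universal

theorem mainTheorem9_general :
    (∀ {k : Type u} {A : Type v} {B : Type w} [Field k] [AddCommGroup A] [Module k A]
      [AddCommGroup B] [Module k B] {oA : DNOps k A} {oB : DNOps k B}
      (hA : IsDendNij oA) (hB : IsDendNij oB),
      ∃ o : DNOps k (augTensor hA hB),
        (∀ c x y, (o c x y : Aug hA ⊗[k] Aug hB) = tensorOp hA hB c x y) ∧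
        IsDendNij o ∧ (IsCommDN oA → IsCommDN oB → IsCommDN o)) ∧
    (∀ {k : Type u} {V : Type v} {F : Type (max u v)} [Field k] [AddCommGroup V] [Module k V]
      [AddCommGroup F] [Module k F] {o : DNOps k F} {i : V →ₗ[k] F} (hF : IsFreeDN o i),
      HasConnectedHopf hF.isDendNij i) ∧
    (∀ {k : Type u} {V : Type v} {F : Type (max u v)} [Field k] [AddCommGroup V] [Module k V]
      [AddCommGroup F] [Module k F] {o : DNOps k F} {i : V →ₗ[k] F} (hF : IsFreeCommDN o i),
      HasConnectedHopf hF.isDendNij i) := by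
  refine ⟨fun hA hB => ⟨augTensorOps hA hB, fun _ _ _ => rfl, isDendNij_augTensorOps hA hB,
    isCommDN_augTensorOps hA hB⟩, fun hF => ?_, fun hF => ?_⟩
  · exact hF.dnGenerates.hasConnectedHopf fun f =>
      (hF.existsUnique_lift _ _ (isDendNij_augTensorOps _ _) f).exists
  · exact hF.dnGenerates.hasConnectedHopf fun f =>
      (hF.existsUnique_lift _ _ (isDendNij_augTensorOps _ _)
        (isCommDN_augTensorOps _ _ hF.isComm hF.isComm) f).exists

theorem mainTheorem9 :
    -- coherence of the unit action
    (∀ {k : Type u} {A : Type v} {B : Type w} [Field k] [CharZero k] [AddCommGroup A]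
      [Module k A] [AddCommGroup B] [Module k B] {oA : DNOps k A} {oB : DNOps k B}
      (hA : IsDendNij oA) (hB : IsDendNij oB),
      ∃ o : DNOps k (augTensor hA hB),
        (∀ c x y, (o c x y : Aug hA ⊗[k] Aug hB) = tensorOp hA hB c x y) ∧
        IsDendNij o ∧ (IsCommDN oA → IsCommDN oB → IsCommDN o)) ∧
    -- the augmented free dendriform-Nijenhuis algebra
    (∀ {k : Type u} {V : Type v} {F : Type (max u v)} [Field k] [CharZero k] [AddCommGroup V]
      [Module k V] [AddCommGroup F] [Module k F] {o : DNOps k F} {i : V →ₗ[k] F}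
      (hF : IsFreeDN o i), HasConnectedHopf hF.isDendNij i) ∧
    -- the augmented free commutative dendriform-Nijenhuis algebra
    (∀ {k : Type u} {V : Type v} {F : Type (max u v)} [Field k] [CharZero k] [AddCommGroup V]
      [Module k V] [AddCommGroup F] [Module k F] {o : DNOps k F} {i : V →ₗ[k] F}
      (hF : IsFreeCommDN o i), HasConnectedHopf hF.isDendNij i) :=
  ⟨mainTheorem9_general.{u, v, w}.1, mainTheorem9_general.{u, v, w}.2.1,
    mainTheorem9_general.{u, v, w}.2.2⟩
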